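/- Let $\alpha_1>\alpha_2>0$, $\beta_1>\beta_2>0$, $\delta>0$ and $\gamma$ be real numbers, and let $\mathcal{P}=\mathcal{P}_{(\alpha_1,\alpha_2),(\beta_1,\beta_2),\delta,\gamma}$ be the unital complex $*$-algebra generated by self-adjoint elements $p_1,p_2,q_1,q_2,s$ subject to the relations $p_ip_j=\delta_{ij}p_i$, $q_iq_j=\delta_{ij}q_i$ (where $\delta_{ij}$ is the Kronecker symbol), $s^2=s$ and $$\alpha_1p_1+\alpha_2p_2+\beta_1q_1+\beta_2q_2+\delta s=\gamma e .$$ A $*$-representation $\pi$ of $\mathcal{P}$ by bounded operators on a complex Hilbert space $H$ (with $\pi(e)=I$) is called non-degenerate if $\pi(p_i)\neq0$, $\pi(q_i)\neq 0$ for $i=1,2$, $\pi(s)\neq0$, $\pi(p_1)+\pi(p_2)\neq I$, $\pi(q_1)+\pi(q_2)\neq I$ and $\pi(s)\neq I$. When $\dim H<\infty$, its generalized dimension is the vector $$(\dim H;\ \operatorname{rank}\pi(p_1),\operatorname{rank}\pi(p_2),\operatorname{rank}\pi(q_1),\operatorname{rank}\pi(q_2),\operatorname{rank}\pi(s)).$$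 Then $\mathcal{P}$ has an irreducible non-degenerate $*$-representation if and only if one of the following two (mutually exclusive) cases occurs. 1. $\gamma>\alpha_1$, $\gamma>\beta_1$, $\alpha_2+\beta_1>\gamma$, $\alpha_1+\beta_2>\gamma$, $\gamma>\alpha_2+\beta_2$ and $3\gamma=\delta+\alpha_1+\alpha_2+\beta_1+\beta_2$. In this case every irreducible non-degenerate $*$-representation has the generalized dimension $(3;1,1,1,1,1)$. 2. $\delta+\beta_1>\gamma$, $\gamma>\delta+\alpha_2$, $\gamma>\delta+\beta_2$, $\delta+\alpha_1>\gamma$, $\delta+\alpha_2+\beta_2>\gamma$ and $3\gamma=2\delta+\alpha_1+\alpha_2+\beta_1+\beta_2$. In this case every irreducible non-degenerate $*$-representation has the generalized dimension $(3;1,1,1,1,2)$. In each of the two cases the irreducible non-degenerate $*$-representation is unique up to unitary equivalence. -/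

import Mathlib

/-- The generators `p_1, …, p_k`, `q_1, …, q_l`, `s_1, …, s_m`. -/
inductive ProjGen (k l m : ℕ) : Type
  | p : Fin k → ProjGen k l m
  | q : Fin l → ProjGen k l m
  | s : Fin m → ProjGen k l m

/-- The defining relations of the algebra `𝒫_{α,β,δ,γ}`. -/
inductive ProjRel {k l m : ℕ} (α : Fin k → ℝ) (β : Fin l → ℝ) (δ : Fin m → ℝ) (γ : ℝ) :
    FreeAlgebra ℂ (ProjGen k l m) → FreeAlgebra ℂ (ProjGen k l m) → Prop
  | pp (i j : Fin k) : ProjRel α β δ γ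
      (FreeAlgebra.ι ℂ (ProjGen.p i) * FreeAlgebra.ι ℂ (ProjGen.p j))
      (if i = j then FreeAlgebra.ι ℂ (ProjGen.p i) else 0)
  | qq (i j : Fin l) : ProjRel α β δ γ
      (FreeAlgebra.ι ℂ (ProjGen.q i) * FreeAlgebra.ι ℂ (ProjGen.q j))
      (if i = j then FreeAlgebra.ι ℂ (ProjGen.q i) else 0)
  | ss (i j : Fin m) : ProjRel α β δ γ
      (FreeAlgebra.ι ℂ (ProjGen.s i) * FreeAlgebra.ι ℂ (ProjGen.s j))
      (if i = j then FreeAlgebra.ι ℂ (ProjGen.s i) else 0)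
  | sum : ProjRel α β δ γ
      (∑ i, (α i : ℂ) • FreeAlgebra.ι ℂ (ProjGen.p i)
        + ∑ j, (β j : ℂ) • FreeAlgebra.ι ℂ (ProjGen.q j)
        + ∑ d, (δ d : ℂ) • FreeAlgebra.ι ℂ (ProjGen.s d))
      ((γ : ℂ) • 1)

/-- The unital complex algebra `𝒫_{α,β,δ,γ}` with generators `p_i`, `q_j`, `s_d` and relations
`p_i p_j = δ_{ij} p_i`, `q_i q_j = δ_{ij} q_i`, `s_i s_j = δ_{ij} s_i`,
`∑ α_i p_i + ∑ β_j q_j + ∑ δ_d s_d = γ e`. -/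
def ProjAlgebra {k l m : ℕ} (α : Fin k → ℝ) (β : Fin l → ℝ) (δ : Fin m → ℝ) (γ : ℝ) : Type :=
  RingQuot (ProjRel α β δ γ)

namespace ProjAlgebra

variable {k l m : ℕ} {α : Fin k → ℝ} {β : Fin l → ℝ} {δ : Fin m → ℝ} {γ : ℝ}

noncomputable instance : Ring (ProjAlgebra α β δ γ) :=
  inferInstanceAs (Ring (RingQuot (ProjRel α β δ γ)))

noncomputable instance : Algebra ℂ (ProjAlgebra α β δ γ) :=
  inferInstanceAs (Algebra ℂ (RingQuot (ProjRel α β δ γ)))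

/-- The quotient map from the free algebra. -/
noncomputable def mk : FreeAlgebra ℂ (ProjGen k l m) →ₐ[ℂ] ProjAlgebra α β δ γ :=
  RingQuot.mkAlgHom ℂ (ProjRel α β δ γ)

/-- The generators, as elements of the algebra. -/
noncomputable def gen (g : ProjGen k l m) : ProjAlgebra α β δ γ :=
  mk (FreeAlgebra.ι ℂ g)

/-- The generator `p_i`. -/
noncomputable def p (i : Fin k) : ProjAlgebra α β δ γ := gen (ProjGen.p i)

/-- The generator `q_j`. -/
noncomputable def q (j : Fin l) : ProjAlgebra α β δ γ := gen (ProjGen.q j)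

/-- The generator `s_d`. -/
noncomputable def s (d : Fin m) : ProjAlgebra α β δ γ := gen (ProjGen.s d)

theorem mk_rel {x y : FreeAlgebra ℂ (ProjGen k l m)} (h : ProjRel α β δ γ x y) :
    (mk x : ProjAlgebra α β δ γ) = mk y :=
  RingQuot.mkAlgHom_rel ℂ h

theorem mk_surjective :
    Function.Surjective (mk : FreeAlgebra ℂ (ProjGen k l m) →ₐ[ℂ] ProjAlgebra α β δ γ) :=
  RingQuot.mkAlgHom_surjective ℂ (ProjRel α β δ γ)

/-- An auxiliary copy of the opposite algebra, with scalars acting through complex conjugation. -/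
def ConjOp {k l m : ℕ} (α : Fin k → ℝ) (β : Fin l → ℝ) (δ : Fin m → ℝ) (γ : ℝ) : Type :=
  (ProjAlgebra α β δ γ)ᵐᵒᵖ

noncomputable instance : Ring (ConjOp α β δ γ) :=
  inferInstanceAs (Ring (ProjAlgebra α β δ γ)ᵐᵒᵖ)

noncomputable instance : Algebra ℂ (ConjOp α β δ γ) :=
  Algebra.compHom (ProjAlgebra α β δ γ)ᵐᵒᵖ (starRingEnd ℂ)

/-- The identity map to the opposite, as an additive equivalence. -/
noncomputable def toConj : ProjAlgebra α β δ γ ≃+ ConjOp α β δ γ := MulOpposite.opAddEquiv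

theorem toConj_mul (x y : ProjAlgebra α β δ γ) : toConj (x * y) = toConj y * toConj x := rfl

theorem toConj_one : toConj (1 : ProjAlgebra α β δ γ) = 1 := rfl

theorem smul_toConj (c : ℂ) (x : ProjAlgebra α β δ γ) :
    c • toConj x = toConj (starRingEnd ℂ c • x) := rfl

theorem lift_rel {x y : FreeAlgebra ℂ (ProjGen k l m)} (h : ProjRel α β δ γ x y) :
    FreeAlgebra.lift ℂ (fun g => toConj (gen g : ProjAlgebra α β δ γ)) x
      = FreeAlgebra.lift ℂ (fun g => toConj (gen g : ProjAlgebra α β δ γ)) y := by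
  have key := mk_rel h
  cases h with
  | pp i j =>
    have key' := mk_rel (ProjRel.pp (α := α) (β := β) (δ := δ) (γ := γ) j i)
    by_cases hij : i = j
    · subst hij
      simp only [if_true, map_mul, FreeAlgebra.lift_ι_apply, ← toConj_mul] at key' ⊢
      exact congrArg toConj key'
    · simp only [if_neg hij, if_neg (Ne.symm hij), map_mul, map_zero, FreeAlgebra.lift_ι_apply,
        ← toConj_mul] at key' ⊢
      rw [← map_zero toConj]
      exact congrArg toConj key'
  | qq i j =>
    have key' := mk_rel (ProjRel.qq (α := α) (β := β) (δ := δ) (γ := γ) j i)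
    by_cases hij : i = j
    · subst hij
      simp only [if_true, map_mul, FreeAlgebra.lift_ι_apply, ← toConj_mul] at key' ⊢
      exact congrArg toConj key'
    · simp only [if_neg hij, if_neg (Ne.symm hij), map_mul, map_zero, FreeAlgebra.lift_ι_apply,
        ← toConj_mul] at key' ⊢
      rw [← map_zero toConj]
      exact congrArg toConj key'
  | ss i j =>
    have key' := mk_rel (ProjRel.ss (α := α) (β := β) (δ := δ) (γ := γ) j i)
    by_cases hij : i = j
    · subst hij
      simp only [if_true, map_mul, FreeAlgebra.lift_ι_apply, ← toConj_mul] at key' ⊢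
      exact congrArg toConj key'
    · simp only [if_neg hij, if_neg (Ne.symm hij), map_mul, map_zero, FreeAlgebra.lift_ι_apply,
        ← toConj_mul] at key' ⊢
      rw [← map_zero toConj]
      exact congrArg toConj key'
  | sum =>
    simp only [map_add, map_sum, map_smul, map_one, FreeAlgebra.lift_ι_apply, smul_toConj,
      Complex.conj_ofReal, ← toConj_one] at key ⊢
    simp only [← map_sum, ← map_add]
    exact congrArg toConj key

/-- The involution, as a conjugate-linear homomorphism to the opposite algebra fixing the
generators. -/
noncomputable def starHom : ProjAlgebra α β δ γ →ₐ[ℂ] ConjOp α β δ γ :=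
  RingQuot.liftAlgHom ℂ
    ⟨FreeAlgebra.lift ℂ (fun g => toConj (gen g : ProjAlgebra α β δ γ)), fun _ _ => lift_rel⟩

theorem starHom_gen (g : ProjGen k l m) :
    starHom (gen g : ProjAlgebra α β δ γ) = toConj (gen g) :=
  (RingQuot.liftAlgHom_mkAlgHom_apply ℂ _ _ _).trans (FreeAlgebra.lift_ι_apply _ _)

noncomputable instance : Star (ProjAlgebra α β δ γ) := ⟨fun x => toConj.symm (starHom x)⟩

theorem star_def (x : ProjAlgebra α β δ γ) : star x = toConj.symm (starHom x) := rfl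

theorem star_gen (g : ProjGen k l m) : star (gen g : ProjAlgebra α β δ γ) = gen g := by
  rw [star_def, starHom_gen, AddEquiv.symm_apply_apply]

theorem star_mul_aux (x y : ProjAlgebra α β δ γ) : star (x * y) = star y * star x := by
  apply toConj.injective
  simp only [star_def, toConj_mul, AddEquiv.apply_symm_apply, map_mul]

theorem star_add_aux (x y : ProjAlgebra α β δ γ) : star (x + y) = star x + star y := by
  simp only [star_def, map_add]

theorem star_smul_aux (c : ℂ) (x : ProjAlgebra α β δ γ) :
    star (c • x) = starRingEnd ℂ c • star x := by
  apply toConj.injective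
  rw [← smul_toConj]
  simp only [star_def, AddEquiv.apply_symm_apply, map_smul]

theorem star_one_aux : star (1 : ProjAlgebra α β δ γ) = 1 := by
  apply toConj.injective
  simp only [star_def, AddEquiv.apply_symm_apply, map_one, toConj_one]

theorem star_star_aux (x : ProjAlgebra α β δ γ) : star (star x) = x := by
  obtain ⟨a, rfl⟩ := mk_surjective x
  induction a using FreeAlgebra.induction with
  | grade0 r =>
    rw [AlgHom.commutes, Algebra.algebraMap_eq_smul_one, star_smul_aux, star_smul_aux,
      star_one_aux, star_one_aux, Complex.conj_conj]
  | grade1 g => exact (congrArg star (star_gen g)).trans (star_gen g)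
  | mul a b ha hb => rw [map_mul, star_mul_aux, star_mul_aux, ha, hb]
  | add a b ha hb => rw [map_add, star_add_aux, star_add_aux, ha, hb]

/-- The involution of `𝒫_{α,β,δ,γ}`: conjugate-linear, anti-multiplicative, and every generator
is self-adjoint. -/
noncomputable instance : StarRing (ProjAlgebra α β δ γ) where
  star_involutive := star_star_aux
  star_mul := star_mul_aux
  star_add := star_add_aux

instance : StarModule ℂ (ProjAlgebra α β δ γ) := ⟨star_smul_aux⟩

end ProjAlgebra

/-- A `*`-representation of `𝒫_{α,β,δ,γ}` on a Hilbert space `H`: a unital `*`-homomorphism to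
the bounded operators on `H`. -/
abbrev ProjRep {k l m : ℕ} (α : Fin k → ℝ) (β : Fin l → ℝ) (δ : Fin m → ℝ) (γ : ℝ)
    (H : Type*) [NormedAddCommGroup H] [InnerProductSpace ℂ H] [CompleteSpace H] :=
  ProjAlgebra α β δ γ →⋆ₐ[ℂ] (H →L[ℂ] H)

namespace ProjRep

variable {k l m : ℕ} {α : Fin k → ℝ} {β : Fin l → ℝ} {δ : Fin m → ℝ} {γ : ℝ}
  {H : Type*} [NormedAddCommGroup H] [InnerProductSpace ℂ H] [CompleteSpace H]
  {H' : Type*} [NormedAddCommGroup H'] [InnerProductSpace ℂ H'] [CompleteSpace H']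

/-- Irreducibility: `H ≠ 0`, and the only closed invariant subspaces are `0` and `H`. -/
def IsIrreducible (π : ProjRep α β δ γ H) : Prop :=
  Nontrivial H ∧ ∀ K : Submodule ℂ H, IsClosed (K : Set H) →
    (∀ a, ∀ x ∈ K, π a x ∈ K) → K = ⊥ ∨ K = ⊤

/-- Non-degeneracy: all `π(p_i)`, `π(q_j)`, `π(s_d)` are nonzero, and none of the three sums
`∑ π(p_i)`, `∑ π(q_j)`, `∑ π(s_d)` is the identity operator. -/
def IsNondegenerate (π : ProjRep α β δ γ H) : Prop :=
  (∀ i, π (ProjAlgebra.p i) ≠ 0) ∧ (∀ j, π (ProjAlgebra.q j) ≠ 0) ∧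
  (∀ d, π (ProjAlgebra.s d) ≠ 0) ∧
  ∑ i, π (ProjAlgebra.p i) ≠ 1 ∧ ∑ j, π (ProjAlgebra.q j) ≠ 1 ∧ ∑ d, π (ProjAlgebra.s d) ≠ 1

/-- Unitary equivalence: some unitary operator `U : H → H'` satisfies `U π(a) = π'(a) U` for
all `a`. -/
def UnitarilyEquivalent (π : ProjRep α β δ γ H) (π' : ProjRep α β δ γ H') : Prop :=
  ∃ U : H ≃ₗᵢ[ℂ] H', ∀ a x, U (π a x) = π' a (U x)

/-- `π` has generalized dimension `(n₀; np; nq; ns)`: the space `H` is finite-dimensional of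
dimension `n₀`, and the images of the projections `π(p_i)`, `π(q_j)`, `π(s_d)` have dimensions
`np i`, `nq j`, `ns d`. -/
def HasGeneralizedDimension (π : ProjRep α β δ γ H) (n₀ : ℕ)
    (np : Fin k → ℕ) (nq : Fin l → ℕ) (ns : Fin m → ℕ) : Prop :=
  FiniteDimensional ℂ H ∧ Module.finrank ℂ H = n₀ ∧
  (∀ i, Module.finrank ℂ (π (ProjAlgebra.p i)).range = np i) ∧
  (∀ j, Module.finrank ℂ (π (ProjAlgebra.q j)).range = nq j) ∧
  (∀ d, Module.finrank ℂ (π (ProjAlgebra.s d)).range = ns d)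

end ProjRep

/-- The conditions on the parameters in the first case. -/
def E6FirstCase (α₁ α₂ β₁ β₂ δ γ : ℝ) : Prop :=
  γ > α₁ ∧ γ > β₁ ∧ α₂ + β₁ > γ ∧ α₁ + β₂ > γ ∧ γ > α₂ + β₂ ∧
  3 * γ = δ + α₁ + α₂ + β₁ + β₂

/-- The conditions on the parameters in the second case. -/
def E6SecondCase (α₁ α₂ β₁ β₂ δ γ : ℝ) : Prop :=
  δ + β₁ > γ ∧ γ > δ + α₂ ∧ γ > δ + β₂ ∧ δ + α₁ > γ ∧ δ + α₂ + β₂ > γ ∧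
  3 * γ = 2 * δ + α₁ + α₂ + β₁ + β₂

universe u v

/-! Put A = α₁p₁ + α₂p₂, B = β₁q₁ + β₂q₂ and let S be the image of s. Non-degeneracy means that A
has exactly the eigenvalues 0, α₁, α₂ and B exactly 0, β₁, β₂, and that S is neither 0 nor 1. Since
B = γ - A - δS, both A and A + δS satisfy cubic equations, and invariance under A and S is
invariance under the whole algebra.

Dimension. If Ax = μx, the two cubics make the span of x, Sx, ASx, A²Sx invariant under A and S
(`exists_invariant_submodule`), so by irreducibility it is H. Any spectral projection of A for an
eigenvalue other than μ kills x and maps the other three vectors to multiples of one vector, so it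
has rank one. Varying μ shows that all three have rank one, hence dim H = 3
(`ProjRep.finrank_eq_three`).

Classification. Now S or 1 - S is a rank one projection vv*, and B = diag(g, g - α₁, g - α₂) - ε vv*
in an eigenbasis of A, with (g, ε) = (γ, δ) or (γ - δ, -δ). Irreducibility makes all coordinates of
v nonzero, and phases in the basis make them positive. Comparing characteristic polynomials gives
`SecularIdentity`, whose values at the diagonal entries determine each |vᵢ|². Hence uniqueness;
positivity of the |vᵢ|² is the interlacing of the two spectra, which gives the inequalities, and the
trace gives the linear equation.

Existence. Conversely, interlacing makes the interpolation formula for |vᵢ|² positive and the trace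
equation makes v a unit vector (`SecularIdentity.exists_of_sign`). By Cayley–Hamilton the resulting
B has the required cubic, and its spectral projections serve as q₁, q₂
(`ProjRep.exists_irreducible`). -/

/-! ### Resolutions of the identity into three projections -/

theorem Orthonormal.exists_orthonormalBasis_eq {H : Type*} [NormedAddCommGroup H]
    [InnerProductSpace ℂ H] {e : Fin 3 → H} (he : Orthonormal ℂ e)
    (h3 : Module.finrank ℂ H = 3) : ∃ b : OrthonormalBasis (Fin 3) ℂ H, ∀ i, b i = e i := by
  have hspan := (basisOfOrthonormalOfCardEqFinrank he (by simp [h3])).span_eq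
  rw [coe_basisOfOrthonormalOfCardEqFinrank] at hspan
  exact ⟨OrthonormalBasis.mk he hspan.ge, fun j => by rw [OrthonormalBasis.coe_mk]⟩

/-- Three nonzero mutually orthogonal orthogonal projections with sum `1`. -/
structure IsResolution {H : Type*} [NormedAddCommGroup H] [InnerProductSpace ℂ H] [CompleteSpace H]
    (P : Fin 3 → H →L[ℂ] H) : Prop where
  mul : ∀ i j, P i * P j = if i = j then P i else 0
  sum : ∑ i, P i = 1
  star : ∀ i, star (P i) = P i
  ne_zero : ∀ i, P i ≠ 0

namespace IsResolution

variable {H : Type*} [NormedAddCommGroup H] [InnerProductSpace ℂ H] [CompleteSpace H]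
  {P : Fin 3 → H →L[ℂ] H}

theorem apply_apply (hP : IsResolution P) (i j : Fin 3) (x : H) :
    P i (P j x) = if i = j then P i x else 0 := by
  have h := congrArg (fun T : H →L[ℂ] H => T x) (hP.mul i j)
  by_cases hij : i = j
  · simpa [hij] using h
  · simpa [hij] using h

theorem inner_apply_left (hP : IsResolution P) (i : Fin 3) (x y : H) :
    inner ℂ (P i x) y = inner ℂ x (P i y) := by
  rw [← ContinuousLinearMap.adjoint_inner_right, ← ContinuousLinearMap.star_eq_adjoint, hP.star]

theorem sum_smul_mul_sum_smul (hP : IsResolution P) (f g : Fin 3 → ℂ) :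
    (∑ i, f i • P i) * (∑ i, g i • P i) = ∑ i, (f i * g i) • P i := by
  simp only [Finset.sum_mul, Finset.mul_sum, smul_mul_smul_comm, hP.mul, smul_ite, smul_zero,
    Finset.sum_ite_eq', Finset.mem_univ, if_true]

theorem sum_smul_sub (hP : IsResolution P) (a : Fin 3 → ℂ) (c : ℂ) :
    ∑ i, a i • P i - c • 1 = ∑ i, (a i - c) • P i := by
  rw [← hP.sum, Finset.smul_sum, ← Finset.sum_sub_distrib]
  simp only [sub_smul]

/-- Lagrange interpolation: for distinct `a`, each projection is a quadratic polynomial in the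
operator, so a subspace invariant under the operator is invariant under each `P j`. -/
theorem smul_eq_mul (hP : IsResolution P) (a : Fin 3 → ℂ) {j k l : Fin 3}
    (hjk : j ≠ k) (hjl : j ≠ l) (hkl : k ≠ l) :
    ((a j - a k) * (a j - a l)) • P j
      = (∑ i, a i • P i - a k • 1) * (∑ i, a i • P i - a l • 1) := by
  rw [hP.sum_smul_sub, hP.sum_smul_sub, hP.sum_smul_mul_sum_smul, Finset.sum_eq_single j]
  · intro i _ hij
    have : i = k ∨ i = l := by omega
    rcases this with rfl | rfl <;> simp
  · simp

theorem cubic (hP : IsResolution P) (a : Fin 3 → ℂ) :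
    (∑ i, a i • P i - a 0 • 1) * (∑ i, a i • P i - a 1 • 1) * (∑ i, a i • P i - a 2 • 1) = 0 := by
  rw [hP.sum_smul_sub, hP.sum_smul_sub, hP.sum_smul_sub, hP.sum_smul_mul_sum_smul,
    hP.sum_smul_mul_sum_smul, Fin.sum_univ_three]
  simp

theorem exists_orthonormal (hP : IsResolution P) :
    ∃ e : Fin 3 → H, Orthonormal ℂ e ∧ ∀ i, P i (e i) = e i := by
  have h : ∀ i, ∃ x, P i x ≠ 0 := fun i => by
    by_contra! h
    exact hP.ne_zero i (ContinuousLinearMap.ext h)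
  choose x hx using h
  refine ⟨fun i => ((‖P i (x i)‖⁻¹ : ℝ) : ℂ) • P i (x i), ⟨fun i => ?_, fun i j hij => ?_⟩,
    fun i => ?_⟩
  · rw [norm_smul, Complex.norm_real, norm_inv, norm_norm, inv_mul_cancel₀]
    exact norm_ne_zero_iff.2 (hx i)
  · dsimp only
    rw [inner_smul_left, inner_smul_right, hP.inner_apply_left, hP.apply_apply, if_neg hij,
      inner_zero_right, mul_zero, mul_zero]
  · rw [map_smul, hP.apply_apply, if_pos rfl]

theorem exists_orthonormalBasis (hP : IsResolution P) (h3 : Module.finrank ℂ H = 3) :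
    ∃ e : OrthonormalBasis (Fin 3) ℂ H, ∀ i, P i = InnerProductSpace.rankOne ℂ (e i) (e i) := by
  obtain ⟨e, he, hPe⟩ := hP.exists_orthonormal
  obtain ⟨b, hbe⟩ := he.exists_orthonormalBasis_eq h3
  refine ⟨b, fun i => ?_⟩
  refine ContinuousLinearMap.coe_injective (b.toBasis.ext fun j => ?_)
  simp only [OrthonormalBasis.coe_toBasis, ContinuousLinearMap.coe_coe,
    InnerProductSpace.rankOne_apply, b.inner_eq_ite]
  rw [hbe, hbe, ← hPe j, hP.apply_apply]
  by_cases hij : i = j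
  · subst hij; simp [hPe]
  · simp [hij]

/-- Unit vectors in the three ranges bound the dimension below; the vectors `y j` span, since x = ∑
P j x. -/
theorem finrank_eq_three (hP : IsResolution P) [FiniteDimensional ℂ H]
    (h : ∀ j, ∃ y, ∀ x, ∃ c : ℂ, P j x = c • y) : Module.finrank ℂ H = 3 := by
  obtain ⟨e, he, -⟩ := hP.exists_orthonormal
  choose y hy using h
  refine le_antisymm ?_ (by simpa using he.linearIndependent.fintype_card_le_finrank)
  have : Submodule.span ℂ (Set.range y) = ⊤ := by
    rw [Submodule.eq_top_iff']
    intro x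
    have hx : x = ∑ j, P j x := by
      rw [← sum_apply, hP.sum]; rfl
    rw [hx]
    refine Submodule.sum_mem _ fun j _ => ?_
    obtain ⟨c, hc⟩ := hy j x
    rw [hc]
    exact Submodule.smul_mem _ _ (Submodule.subset_span ⟨j, rfl⟩)
  rw [← finrank_top, ← this]
  exact (finrank_range_le_card (R := ℂ) y).trans_eq (by simp)

end IsResolution

/-! ### Rank one projections -/

section Projection

variable {H : Type*} [NormedAddCommGroup H] [InnerProductSpace ℂ H] [CompleteSpace H]

theorem exists_eq_rankOne_of_finrank_range_eq_one {T : H →L[ℂ] H} (hT : IsStarProjection T)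
    (h1 : Module.finrank ℂ T.range = 1) :
    ∃ v : H, ‖v‖ = 1 ∧ T = InnerProductSpace.rankOne ℂ v v := by
  obtain ⟨⟨w, hw⟩, hw0, hspan⟩ := finrank_eq_one_iff'.1 h1
  have hw0' : w ≠ 0 := fun h => hw0 (Subtype.ext h)
  have hTT : ∀ x, T (T x) = T x := fun x =>
    congrArg (fun R : H →L[ℂ] H => R x) hT.isIdempotentElem
  have hTi : ∀ x y, inner ℂ (T x) y = inner ℂ x (T y) := fun x y => by
    rw [← ContinuousLinearMap.adjoint_inner_right, ← ContinuousLinearMap.star_eq_adjoint,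
      hT.isSelfAdjoint.star_eq]
  have hTw : T w = w := by
    obtain ⟨u, rfl⟩ := hw
    exact hTT u
  set v : H := ((‖w‖⁻¹ : ℝ) : ℂ) • w with hv
  have hv1 : ‖v‖ = 1 := by
    rw [hv, norm_smul, Complex.norm_real, norm_inv, norm_norm,
      inv_mul_cancel₀ (norm_ne_zero_iff.2 hw0')]
  have hTv : T v = v := by rw [hv, map_smul, hTw]
  refine ⟨v, hv1, ContinuousLinearMap.ext fun x => ?_⟩
  obtain ⟨c, hc⟩ := hspan ⟨T x, x, rfl⟩
  have hc' : c • w = T x := congrArg Subtype.val hc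
  have hwv : w = (‖w‖ : ℂ) • v := by
    rw [hv, smul_smul, ← Complex.ofReal_mul, mul_inv_cancel₀ (norm_ne_zero_iff.2 hw0'),
      Complex.ofReal_one, one_smul]
  rw [InnerProductSpace.rankOne_apply, ← hTv, hTi, ← hc', hTv, hwv, smul_smul, inner_smul_right,
    inner_self_eq_norm_sq_to_K, hv1]
  simp

end Projection

/-! ### A finite-dimensional invariant subspace -/

section Cyclic

variable {H : Type*} [NormedAddCommGroup H] [InnerProductSpace ℂ H]

/-- An eigenvector of `A` generates a finite-dimensional subspace invariant under `A` and the
idempotent `S`, if both `A` and `C = A + δ S` satisfy cubic equations. -/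
theorem exists_invariant_submodule {A S : H →L[ℂ] H} {δ μ : ℂ} {a c : Fin 3 → ℂ} (hδ : δ ≠ 0)
    (hS : IsIdempotentElem S)
    (hA : (A - a 0 • 1) * (A - a 1 • 1) * (A - a 2 • 1) = 0)
    (hC : (A + δ • S - c 0 • 1) * (A + δ • S - c 1 • 1) * (A + δ • S - c 2 • 1) = 0)
    {x : H} (hx : A x = μ • x) :
    let V := Submodule.span ℂ {x, S x, A (S x), A (A (S x))}
    (∀ y ∈ V, A y ∈ V) ∧ ∀ y ∈ V, S y ∈ V := by
  intro V
  have hx0 : x ∈ V := Submodule.subset_span (by simp)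
  have hx1 : S x ∈ V := Submodule.subset_span (by simp)
  have hx2 : A (S x) ∈ V := Submodule.subset_span (by simp)
  have hx3 : A (A (S x)) ∈ V := Submodule.subset_span (by simp)
  have hSS : ∀ y, S (S y) = S y := fun y => congrArg (fun R : H →L[ℂ] H => R y) hS
  have hA' : ∀ y, A (A (A y)) = (a 0 + a 1 + a 2) • A (A y)
      - (a 0 * a 1 + a 0 * a 2 + a 1 * a 2) • A y + (a 0 * a 1 * a 2) • y := fun y => by
    have h := congrArg (fun R : H →L[ℂ] H => R y) hA
    simp at h
    rw [← sub_eq_zero, ← h]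
    module
  -- Expand the cubic of A + δS at the eigenvector x: every word in A and S reduces to one of x, Sx,
  -- ASx, A²Sx except SASx, which occurs with coefficient δ².
  have hC' : δ ^ 2 • S (A (S x)) = (c 0 + c 1 + c 2) •
        (δ ^ 2 • S x + δ • (μ • S x + A (S x)) + μ ^ 2 • x)
      - (c 0 * c 1 + c 0 * c 2 + c 1 * c 2) • (μ • x + δ • S x) + (c 0 * c 1 * c 2) • x
      - (δ ^ 3 • S x + δ ^ 2 • (μ • S x + A (S x))
        + δ • (μ ^ 2 • S x + μ • A (S x) + A (A (S x))) + μ ^ 3 • x) := by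
    have h := congrArg (fun R : H →L[ℂ] H => R x) hC
    simp [hx, hSS] at h
    rw [← sub_eq_zero, ← h]
    module
  have hδ2 : δ ^ 2 ≠ 0 := pow_ne_zero 2 hδ
  have h1 : S (A (S x)) ∈ V := by
    rw [← Submodule.smul_mem_iff V hδ2, hC']
    refine V.sub_mem (V.add_mem (V.sub_mem (V.smul_mem _ ?_) (V.smul_mem _ ?_)) (V.smul_mem _ hx0))
      ?_
    · exact V.add_mem (V.add_mem (V.smul_mem _ hx1)
        (V.smul_mem _ (V.add_mem (V.smul_mem _ hx1) hx2))) (V.smul_mem _ hx0)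
    · exact V.add_mem (V.smul_mem _ hx0) (V.smul_mem _ hx1)
    · exact V.add_mem (V.add_mem (V.add_mem (V.smul_mem _ hx1)
        (V.smul_mem _ (V.add_mem (V.smul_mem _ hx1) hx2))) (V.smul_mem _
        (V.add_mem (V.add_mem (V.smul_mem _ hx1) (V.smul_mem _ hx2)) hx3))) (V.smul_mem _ hx0)
  -- Applying S to the previous relation leaves SA²Sx, with coefficient δ, as the only new vector.
  have h2 : S (A (A (S x))) ∈ V := by
    have h := congrArg S hC'
    simp only [map_add, map_sub, map_smul, hSS] at h
    have h' : δ • S (A (A (S x))) = (c 0 + c 1 + c 2) •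
        (δ ^ 2 • S x + δ • (μ • S x + S (A (S x))) + μ ^ 2 • S x)
      - (c 0 * c 1 + c 0 * c 2 + c 1 * c 2) • (μ • S x + δ • S x) + (c 0 * c 1 * c 2) • S x
      - (δ ^ 3 • S x + δ ^ 2 • (μ • S x + S (A (S x)))
        + δ • (μ ^ 2 • S x + μ • S (A (S x))) + μ ^ 3 • S x) - δ ^ 2 • S (A (S x)) := by
      rw [h]; module
    rw [← Submodule.smul_mem_iff V hδ, h']
    refine V.sub_mem (V.sub_mem (V.add_mem (V.sub_mem (V.smul_mem _ ?_) (V.smul_mem _ ?_))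
      (V.smul_mem _ hx1)) ?_) (V.smul_mem _ h1)
    · exact V.add_mem (V.add_mem (V.smul_mem _ hx1)
        (V.smul_mem _ (V.add_mem (V.smul_mem _ hx1) h1))) (V.smul_mem _ hx1)
    · exact V.add_mem (V.smul_mem _ hx1) (V.smul_mem _ hx1)
    · exact V.add_mem (V.add_mem (V.add_mem (V.smul_mem _ hx1)
        (V.smul_mem _ (V.add_mem (V.smul_mem _ hx1) h1))) (V.smul_mem _
        (V.add_mem (V.smul_mem _ hx1) (V.smul_mem _ h1)))) (V.smul_mem _ hx1)
  constructor
  · refine fun y hy => (Submodule.span_le (p := V.comap (A : H →ₗ[ℂ] H))).2 ?_ hy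
    rintro z (rfl | rfl | rfl | rfl)
    · change A z ∈ V
      rw [hx]
      exact V.smul_mem _ hx0
    · exact hx2
    · exact hx3
    · change A (A (A (S x))) ∈ V
      rw [hA']
      exact V.add_mem (V.sub_mem (V.smul_mem _ hx3) (V.smul_mem _ hx2)) (V.smul_mem _ hx1)
  · refine fun y hy => (Submodule.span_le (p := V.comap (S : H →ₗ[ℂ] H))).2 ?_ hy
    rintro z (rfl | rfl | rfl | rfl)
    · exact hx1
    · change S (S x) ∈ V
      rwa [hSS]
    · exact h1
    · exact h2

end Cyclic

/-! ### Characteristic polynomials of rank one perturbations -/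

section RankOnePerturbation

variable {H : Type*} [NormedAddCommGroup H] [InnerProductSpace ℂ H]

/-- The characteristic polynomial of a rank one perturbation of a diagonal operator. -/
theorem eval_charpoly_diagonal_sub_rankOne [FiniteDimensional ℂ H]
    (e : OrthonormalBasis (Fin 3) ℂ H)
    (d : Fin 3 → ℂ) (ε : ℂ) {v : H} {r : Fin 3 → ℝ} (hr : ∀ i, inner ℂ (e i) v = r i) (z : ℂ) :
    (((∑ i, d i • InnerProductSpace.rankOne ℂ (e i) (e i)
      - ε • InnerProductSpace.rankOne ℂ v v : H →L[ℂ] H) : H →ₗ[ℂ] H).charpoly).eval z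
      = (z - d 0) * (z - d 1) * (z - d 2) + ε * ((r 0 : ℂ) ^ 2 * ((z - d 1) * (z - d 2))
        + (r 1 : ℂ) ^ 2 * ((z - d 0) * (z - d 2)) + (r 2 : ℂ) ^ 2 * ((z - d 0) * (z - d 1))) := by
  rw [← LinearMap.charpoly_toMatrix _ e.toBasis]
  have hr' : ∀ i, inner ℂ v (e i) = r i := fun i => by
    rw [← inner_conj_symm, hr, Complex.conj_ofReal]
  have hM : LinearMap.toMatrix e.toBasis e.toBasis
      ((∑ i, d i • InnerProductSpace.rankOne ℂ (e i) (e i)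
      - ε • InnerProductSpace.rankOne ℂ v v : H →L[ℂ] H) : H →ₗ[ℂ] H)
      = Matrix.of fun i j => (if i = j then d i else 0) - ε * (r i * r j) := by
    ext i j
    rw [LinearMap.toMatrix_apply, OrthonormalBasis.coe_toBasis_repr_apply,
      OrthonormalBasis.repr_apply_apply]
    by_cases hij : i = j
    · subst hij
      simp [-Complex.coe_smul, hr, hr', e.inner_eq_ite, inner_sub_right, inner_smul_right]
    · simp [-Complex.coe_smul, hr, hr', e.inner_eq_ite, inner_sub_right, inner_smul_right, hij,
        mul_comm]
  rw [hM, Matrix.eval_charpoly, Matrix.det_fin_three]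
  simp
  ring

theorem eval_charpoly_diagonal [FiniteDimensional ℂ H] (e : OrthonormalBasis (Fin 3) ℂ H)
    (d : Fin 3 → ℂ) (z : ℂ) :
    (((∑ i, d i • InnerProductSpace.rankOne ℂ (e i) (e i) : H →L[ℂ] H) :
      H →ₗ[ℂ] H).charpoly).eval z = (z - d 0) * (z - d 1) * (z - d 2) := by
  have h := eval_charpoly_diagonal_sub_rankOne e d 0 (v := 0) (r := 0) (by simp) z
  simpa using h

end RankOnePerturbation

/-! ### The secular identity and interlacing -/

/-- The monic cubic with roots `b` is the characteristic polynomial of the rank one perturbation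
`diag d - ε v vᵀ`, where `x i = |v i|²`. -/
def SecularIdentity (d b x : Fin 3 → ℝ) (ε : ℝ) : Prop :=
  ∀ z : ℝ, (z - b 0) * (z - b 1) * (z - b 2) = (z - d 0) * (z - d 1) * (z - d 2)
    + ε * (x 0 * ((z - d 1) * (z - d 2)) + x 1 * ((z - d 0) * (z - d 2))
      + x 2 * ((z - d 0) * (z - d 1)))

namespace SecularIdentity

variable {d b x y : Fin 3 → ℝ} {ε : ℝ}

theorem trace (h : SecularIdentity d b x ε) :
    b 0 + b 1 + b 2 = d 0 + d 1 + d 2 - ε * (x 0 + x 1 + x 2) := by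
  -- The second difference at 0 extracts the coefficient of z² in a cubic.
  linear_combination (1 / 2) * (2 * h 0 - h 1 - h (-1))

/-- At z = d i only the summand with x i survives, and its factor is nonzero. -/
theorem unique (h : SecularIdentity d b x ε) (h' : SecularIdentity d b y ε) (hε : ε ≠ 0)
    (h01 : d 0 ≠ d 1) (h02 : d 0 ≠ d 2) (h12 : d 1 ≠ d 2) : x = y := by
  have h01 := sub_ne_zero.2 h01
  have h02 := sub_ne_zero.2 h02
  have h12 := sub_ne_zero.2 h12
  funext i
  fin_cases i
  · refine mul_left_cancel₀ (mul_ne_zero hε (mul_ne_zero h01 h02)) ?_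
    simp only [Fin.zero_eta]
    linear_combination h' (d 0) - h (d 0)
  · refine mul_left_cancel₀ (mul_ne_zero hε (mul_ne_zero h01 h12)) ?_
    simp only [Fin.mk_one]
    linear_combination h (d 1) - h' (d 1)
  · refine mul_left_cancel₀ (mul_ne_zero hε (mul_ne_zero h02 h12)) ?_
    simp only [Fin.reduceFinMk]
    linear_combination h' (d 2) - h (d 2)

/-- The interlacing inequalities for a positive perturbation. -/
theorem interlacing_of_pos {a₁ a₂ b₁ b₂ g : ℝ} (ha₂ : 0 < a₂) (ha : a₂ < a₁) (hb₂ : 0 < b₂)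
    (hb : b₂ < b₁) (hε : 0 < ε) (hx : ∀ i, 0 < x i)
    (h : SecularIdentity ![g, g - a₁, g - a₂] ![0, b₁, b₂] x ε) :
    b₁ < g ∧ g - a₂ < b₁ ∧ b₂ < g - a₂ ∧ g - a₁ < b₂ ∧ 0 < g - a₁ := by
  -- At each diagonal entry one summand survives, so positivity of `x` fixes the sign of z(z - b₁)(z
  -- - b₂) there. The signs at g, g - a₁, g - a₂ are +, +, -, which forces 0 < g - a₁ < b₂ < g - a₂
  -- < b₁ < g.
  have h0 := h g
  have h1 := h (g - a₁)
  have h2 := h (g - a₂)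
  simp at h0 h1 h2
  have p0 : 0 < g * (g - b₁) * (g - b₂) := by
    rw [h0]; have := hx 0; have := ha₂.trans ha; positivity
  have p1 : 0 < (g - a₁) * (g - a₁ - b₁) * (g - a₁ - b₂) := by
    have := hx 1; have := ha₂.trans ha; have := sub_pos.2 ha
    have e : (g - a₁) * (g - a₁ - b₁) * (g - a₁ - b₂) = ε * (x 1 * (a₁ * (a₁ - a₂))) := by
      linear_combination h1
    rw [e]; positivity
  have p2 : (g - a₂) * (g - a₂ - b₁) * (g - a₂ - b₂) < 0 := by
    have := hx 2; have := sub_pos.2 ha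
    have e : (g - a₂) * (g - a₂ - b₁) * (g - a₂ - b₂) = -(ε * (x 2 * (a₂ * (a₁ - a₂)))) := by
      linear_combination h2
    rw [e, neg_lt_zero]; positivity
  clear h0 h1 h2 h
  have q1 : 0 < g - a₁ := by
    by_contra! hn
    have : 0 ≤ (g - a₁ - b₁) * (g - a₁ - b₂) :=
      mul_nonneg_of_nonpos_of_nonpos (by linarith) (by linarith)
    have := mul_nonpos_of_nonpos_of_nonneg hn this
    linarith
  have q2 : g - a₂ < b₁ := by
    by_contra! hn
    have : 0 ≤ (g - a₂) * (g - a₂ - b₁) * (g - a₂ - b₂) :=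
      mul_nonneg (mul_nonneg (by linarith) (by linarith)) (by linarith)
    linarith
  have q3 : b₂ < g - a₂ := by
    by_contra! hn
    have : 0 ≤ (g - a₂) * (g - a₂ - b₁) * (g - a₂ - b₂) := by
      rw [mul_assoc]
      exact mul_nonneg (by linarith) (mul_nonneg_of_nonpos_of_nonpos (by linarith) (by linarith))
    linarith
  have q4 : b₁ < g := by
    by_contra! hn
    have : g * (g - b₁) * (g - b₂) ≤ 0 :=
      mul_nonpos_of_nonpos_of_nonneg (mul_nonpos_of_nonneg_of_nonpos (by linarith) (by linarith))
        (by linarith)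
    linarith
  have q5 : g - a₁ < b₂ := by
    by_contra! hn
    have : (g - a₁) * (g - a₁ - b₁) * (g - a₁ - b₂) ≤ 0 :=
      mul_nonpos_of_nonpos_of_nonneg (mul_nonpos_of_nonneg_of_nonpos (by linarith) (by linarith))
        (by linarith)
    linarith
  exact ⟨q4, q2, q3, q5, q1⟩

/-- The interlacing inequalities for a negative perturbation. -/
theorem interlacing_of_neg {a₁ a₂ b₁ b₂ g : ℝ} (ha₂ : 0 < a₂) (ha : a₂ < a₁) (hb₂ : 0 < b₂)
    (hb : b₂ < b₁) (hε : 0 < ε) (hx : ∀ i, 0 < x i)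
    (h : SecularIdentity ![g, g - a₁, g - a₂] ![0, b₁, b₂] x (-ε)) :
    g < b₁ ∧ b₂ < g ∧ g - a₂ < b₂ ∧ 0 < g - a₂ ∧ g - a₁ < 0 := by
  -- All three signs are now reversed, which forces g - a₁ < 0 < g - a₂ < b₂ < g < b₁.
  have h0 := h g
  have h1 := h (g - a₁)
  have h2 := h (g - a₂)
  simp at h0 h1 h2
  have p0 : g * (g - b₁) * (g - b₂) < 0 := by
    rw [h0, neg_lt_zero]; have := hx 0; have := ha₂.trans ha; positivity
  have p1 : (g - a₁) * (g - a₁ - b₁) * (g - a₁ - b₂) < 0 := by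
    have := hx 1; have := ha₂.trans ha; have := sub_pos.2 ha
    have e : (g - a₁) * (g - a₁ - b₁) * (g - a₁ - b₂) = -(ε * (x 1 * (a₁ * (a₁ - a₂)))) := by
      linear_combination h1
    rw [e, neg_lt_zero]; positivity
  have p2 : 0 < (g - a₂) * (g - a₂ - b₁) * (g - a₂ - b₂) := by
    have := hx 2; have := sub_pos.2 ha
    have e : (g - a₂) * (g - a₂ - b₁) * (g - a₂ - b₂) = ε * (x 2 * (a₂ * (a₁ - a₂))) := by
      linear_combination h2
    rw [e]; positivity
  clear h0 h1 h2 h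
  have q1 : 0 < g - a₂ := by
    by_contra! hn
    have : 0 ≤ (g - a₂ - b₁) * (g - a₂ - b₂) :=
      mul_nonneg_of_nonpos_of_nonpos (by linarith) (by linarith)
    have := mul_nonpos_of_nonpos_of_nonneg hn this
    linarith
  have q2 : g < b₁ := by
    by_contra! hn
    have : 0 ≤ g * (g - b₁) * (g - b₂) :=
      mul_nonneg (mul_nonneg (by linarith) (by linarith)) (by linarith)
    linarith
  have q3 : b₂ < g := by
    by_contra! hn
    have : 0 ≤ g * (g - b₁) * (g - b₂) := by
      rw [mul_assoc]
      exact mul_nonneg (by linarith) (mul_nonneg_of_nonpos_of_nonpos (by linarith) (by linarith))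
    linarith
  have q4 : g - a₂ < b₂ := by
    by_contra! hn
    have : (g - a₂) * (g - a₂ - b₁) * (g - a₂ - b₂) ≤ 0 :=
      mul_nonpos_of_nonpos_of_nonneg (mul_nonpos_of_nonneg_of_nonpos (by linarith) (by linarith))
        (by linarith)
    linarith
  have q5 : g - a₁ < 0 := by
    by_contra! hn
    have : 0 ≤ (g - a₁) * (g - a₁ - b₁) * (g - a₁ - b₂) := by
      rw [mul_assoc]
      exact mul_nonneg (by linarith) (mul_nonneg_of_nonpos_of_nonpos (by linarith) (by linarith))
    linarith
  exact ⟨q2, q3, q4, q1, q5⟩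

/-- Lagrange interpolation at the nodes `d`. -/
theorem of_lagrange (h01 : d 0 ≠ d 1) (h02 : d 0 ≠ d 2) (h12 : d 1 ≠ d 2)
    (h0 : ε * x 0 = (d 0 - b 0) * (d 0 - b 1) * (d 0 - b 2) / ((d 0 - d 1) * (d 0 - d 2)))
    (h1 : ε * x 1 = (d 1 - b 0) * (d 1 - b 1) * (d 1 - b 2) / ((d 1 - d 0) * (d 1 - d 2)))
    (h2 : ε * x 2 = (d 2 - b 0) * (d 2 - b 1) * (d 2 - b 2) / ((d 2 - d 0) * (d 2 - d 1))) :
    SecularIdentity d b x ε := by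
  intro z
  have h01' := sub_ne_zero.2 h01
  have h02' := sub_ne_zero.2 h02
  have h12' := sub_ne_zero.2 h12
  have h10' := sub_ne_zero.2 h01.symm
  have h20' := sub_ne_zero.2 h02.symm
  have h21' := sub_ne_zero.2 h12.symm
  simp only [mul_add, ← mul_assoc, h0, h1, h2]
  field_simp
  ring

end SecularIdentity

/-! ### Relations and generation of the algebra -/

namespace ProjAlgebra

variable {k l m : ℕ} {α : Fin k → ℝ} {β : Fin l → ℝ} {δ : Fin m → ℝ} {γ : ℝ}

theorem p_mul_p (i j : Fin k) :
    (p i * p j : ProjAlgebra α β δ γ) = if i = j then p i else 0 := by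
  have h := mk_rel (ProjRel.pp (α := α) (β := β) (δ := δ) (γ := γ) i j)
  rw [map_mul] at h
  refine h.trans ?_
  split_ifs
  · rfl
  · exact map_zero _

theorem q_mul_q (i j : Fin l) :
    (q i * q j : ProjAlgebra α β δ γ) = if i = j then q i else 0 := by
  have h := mk_rel (ProjRel.qq (α := α) (β := β) (δ := δ) (γ := γ) i j)
  rw [map_mul] at h
  refine h.trans ?_
  split_ifs
  · rfl
  · exact map_zero _

theorem s_mul_s (i j : Fin m) :
    (s i * s j : ProjAlgebra α β δ γ) = if i = j then s i else 0 := by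
  have h := mk_rel (ProjRel.ss (α := α) (β := β) (δ := δ) (γ := γ) i j)
  rw [map_mul] at h
  refine h.trans ?_
  split_ifs
  · rfl
  · exact map_zero _

theorem sum_eq : ∑ i, (α i : ℂ) • p i + ∑ j, (β j : ℂ) • q j + ∑ d, (δ d : ℂ) • s d
    = (γ : ℂ) • (1 : ProjAlgebra α β δ γ) := by
  have h := mk_rel (ProjRel.sum (α := α) (β := β) (δ := δ) (γ := γ))
  simp only [map_add, map_sum, map_smul, map_one] at h
  exact h

theorem subalgebra_eq_top_of_gen_mem (U : Subalgebra ℂ (ProjAlgebra α β δ γ))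
    (h : ∀ g, gen g ∈ U) : U = ⊤ := by
  rw [eq_top_iff]
  intro a _
  obtain ⟨a, rfl⟩ := mk_surjective a
  induction a using FreeAlgebra.induction with
  | grade0 r => rw [AlgHom.commutes]; exact U.algebraMap_mem r
  | grade1 g => exact h g
  | mul a b ha hb => rw [map_mul]; exact U.mul_mem (ha trivial) (hb trivial)
  | add a b ha hb => rw [map_add]; exact U.add_mem (ha trivial) (hb trivial)

/-- The linear relation expresses B = β₁q₁ + β₂q₂ through the p's and s's, and q₁, q₂ are quadratic
polynomials in B. Hence invariance and intertwining need checking only on the p's and s's. -/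
theorem subalgebra_eq_top {α : Fin k → ℝ} {β₁ β₂ : ℝ} {δ : Fin m → ℝ} {γ : ℝ}
    (U : Subalgebra ℂ (ProjAlgebra α ![β₁, β₂] δ γ)) (hβ₁ : β₁ ≠ 0) (hβ₂ : β₂ ≠ 0)
    (hβ : β₁ ≠ β₂) (hp : ∀ i, p i ∈ U) (hs : ∀ d, s d ∈ U) : U = ⊤ := by
  set B : ProjAlgebra α ![β₁, β₂] δ γ := (β₁ : ℂ) • q 0 + (β₂ : ℂ) • q 1 with hB
  have hBU : B ∈ U := by
    have h : B = (γ : ℂ) • 1 - ∑ i, (α i : ℂ) • p i - ∑ d, (δ d : ℂ) • s d := by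
      rw [← sum_eq, hB, Fin.sum_univ_two]
      simp only [Matrix.cons_val_zero, Matrix.cons_val_one]
      abel
    rw [h]
    exact U.sub_mem (U.sub_mem (U.smul_mem U.one_mem _)
      (U.sum_mem fun i _ => U.smul_mem (hp i) _)) (U.sum_mem fun d _ => U.smul_mem (hs d) _)
  have hB2 : B * B = ((β₁ : ℂ) ^ 2) • q 0 + ((β₂ : ℂ) ^ 2) • q 1 := by
    simp [hB, add_mul, mul_add, q_mul_q, smul_smul, sq, -Complex.coe_smul]
  have hβ₁' : (β₁ : ℂ) ≠ 0 := by exact_mod_cast hβ₁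
  have hβ₂' : (β₂ : ℂ) ≠ 0 := by exact_mod_cast hβ₂
  have hβ' : (β₁ : ℂ) - β₂ ≠ 0 := sub_ne_zero.2 (by exact_mod_cast hβ)
  have hB2U : B * B ∈ U := U.mul_mem hBU hBU
  refine subalgebra_eq_top_of_gen_mem U fun g => ?_
  rcases g with i | j | d
  · exact hp i
  · have h0 : (q 0 : ProjAlgebra α ![β₁, β₂] δ γ)
        = ((β₁ * (β₁ - β₂) : ℂ)⁻¹) • (B * B - (β₂ : ℂ) • B) := by
      rw [eq_inv_smul_iff₀ (mul_ne_zero hβ₁' hβ'), hB2, hB]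
      module
    have h1 : (q 1 : ProjAlgebra α ![β₁, β₂] δ γ)
        = ((β₂ * (β₁ - β₂) : ℂ)⁻¹) • ((β₁ : ℂ) • B - B * B) := by
      rw [eq_inv_smul_iff₀ (mul_ne_zero hβ₂' hβ'), hB2, hB]
      module
    change q j ∈ U
    fin_cases j
    · exact h0 ▸ U.smul_mem (U.sub_mem hB2U (U.smul_mem hBU _)) _
    · exact h1 ▸ U.smul_mem (U.sub_mem (U.smul_mem hBU _) hB2U) _
  · exact hs d

end ProjAlgebra

/-! ### Irreducible non-degenerate representations are three-dimensional -/

namespace ProjRep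

variable {H : Type*} [NormedAddCommGroup H] [InnerProductSpace ℂ H] [CompleteSpace H]

theorem mem_of_mem {k m : ℕ} {α : Fin k → ℝ} {β₁ β₂ : ℝ} {δ : Fin m → ℝ} {γ : ℝ}
    (π : ProjRep α ![β₁, β₂] δ γ H) (hβ₁ : β₁ ≠ 0) (hβ₂ : β₂ ≠ 0)
    (hβ : β₁ ≠ β₂) (K : Submodule ℂ H) (hp : ∀ i, ∀ x ∈ K, π (ProjAlgebra.p i) x ∈ K)
    (hs : ∀ d, ∀ x ∈ K, π (ProjAlgebra.s d) x ∈ K) (a) : ∀ x ∈ K, π a x ∈ K := by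
  let U : Subalgebra ℂ (ProjAlgebra α ![β₁, β₂] δ γ) :=
    { carrier := {a | ∀ x ∈ K, π a x ∈ K}
      mul_mem' := fun {a b} ha hb x hx => by
        rw [map_mul]
        exact ha _ (hb x hx)
      add_mem' := fun {a b} ha hb x hx => by
        rw [map_add]
        exact K.add_mem (ha x hx) (hb x hx)
      algebraMap_mem' := fun c x hx => by
        rw [AlgHomClass.commutes, Algebra.algebraMap_eq_smul_one]
        exact K.smul_mem c hx }
  have hU : U = ⊤ := ProjAlgebra.subalgebra_eq_top U hβ₁ hβ₂ hβ hp hs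
  exact (hU ▸ Algebra.mem_top : a ∈ U)

theorem intertwines {H' : Type*} [NormedAddCommGroup H'] [InnerProductSpace ℂ H']
    [CompleteSpace H'] {k m : ℕ} {α : Fin k → ℝ} {β₁ β₂ : ℝ} {δ : Fin m → ℝ} {γ : ℝ}
    (π : ProjRep α ![β₁, β₂] δ γ H) (π' : ProjRep α ![β₁, β₂] δ γ H')
    (hβ₁ : β₁ ≠ 0) (hβ₂ : β₂ ≠ 0) (hβ : β₁ ≠ β₂) (V : H ≃ₗᵢ[ℂ] H')
    (hp : ∀ i x, V (π (ProjAlgebra.p i) x) = π' (ProjAlgebra.p i) (V x))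
    (hs : ∀ d x, V (π (ProjAlgebra.s d) x) = π' (ProjAlgebra.s d) (V x)) (a) :
    ∀ x, V (π a x) = π' a (V x) := by
  let U : Subalgebra ℂ (ProjAlgebra α ![β₁, β₂] δ γ) :=
    { carrier := {a | ∀ x, V (π a x) = π' a (V x)}
      mul_mem' := fun {a b} ha hb x => by
        rw [map_mul, map_mul]
        exact (ha _).trans (congrArg (π' a) (hb x))
      add_mem' := fun {a b} ha hb x => by
        rw [map_add, map_add]
        simp only [add_apply, map_add]
        rw [ha, hb]
      algebraMap_mem' := fun c x => by
        rw [AlgHomClass.commutes, AlgHomClass.commutes, Algebra.algebraMap_eq_smul_one,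
          Algebra.algebraMap_eq_smul_one]
        exact map_smul V c x }
  have hU : U = ⊤ := ProjAlgebra.subalgebra_eq_top U hβ₁ hβ₂ hβ hp hs
  exact (hU ▸ Algebra.mem_top : a ∈ U)

variable {α₁ α₂ β₁ β₂ δ γ : ℝ}

/-- The resolution of the identity `1 - π(p₁) - π(p₂), π(p₁), π(p₂)`. -/
noncomputable def P (π : ProjRep ![α₁, α₂] ![β₁, β₂] ![δ] γ H) : Fin 3 → H →L[ℂ] H :=
  ![1 - π (ProjAlgebra.p 0) - π (ProjAlgebra.p 1), π (ProjAlgebra.p 0), π (ProjAlgebra.p 1)]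

/-- The resolution of the identity `1 - π(q₁) - π(q₂), π(q₁), π(q₂)`. -/
noncomputable def Q (π : ProjRep ![α₁, α₂] ![β₁, β₂] ![δ] γ H) : Fin 3 → H →L[ℂ] H :=
  ![1 - π (ProjAlgebra.q 0) - π (ProjAlgebra.q 1), π (ProjAlgebra.q 0), π (ProjAlgebra.q 1)]

theorem isResolution_of_projections {p₁ p₂ : H →L[ℂ] H} (h11 : p₁ * p₁ = p₁) (h12 : p₁ * p₂ = 0)
    (h21 : p₂ * p₁ = 0) (h22 : p₂ * p₂ = p₂) (hs1 : star p₁ = p₁) (hs2 : star p₂ = p₂)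
    (h1 : p₁ ≠ 0) (h2 : p₂ ≠ 0) (h : p₁ + p₂ ≠ 1) :
    IsResolution ![1 - p₁ - p₂, p₁, p₂] where
  mul i j := by
    fin_cases i <;> fin_cases j <;> simp [mul_sub, sub_mul, h11, h12, h21, h22]
  sum := by
    simp [Fin.sum_univ_three]
    abel
  star i := by fin_cases i <;> simp [hs1, hs2]
  ne_zero i := by
    fin_cases i
    · simpa [sub_sub, sub_eq_zero] using h.symm
    · exact h1
    · exact h2

theorem star_apply_gen {k l m : ℕ} {α : Fin k → ℝ} {β : Fin l → ℝ} {δ : Fin m → ℝ} {γ : ℝ}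
    (π : ProjRep α β δ γ H) (g) : star (π (ProjAlgebra.gen g)) = π (ProjAlgebra.gen g) := by
  rw [← map_star, ProjAlgebra.star_gen]

theorem isResolution_P {π : ProjRep ![α₁, α₂] ![β₁, β₂] ![δ] γ H} (hπ : π.IsNondegenerate) :
    IsResolution π.P := by
  have h := fun i j => congrArg π (ProjAlgebra.p_mul_p (α := ![α₁, α₂]) (β := ![β₁, β₂])
    (δ := ![δ]) (γ := γ) i j)
  simp only [map_mul] at h
  exact isResolution_of_projections (by simpa using h 0 0) (by simpa using h 0 1)
    (by simpa using h 1 0) (by simpa using h 1 1) (π.star_apply_gen _) (π.star_apply_gen _)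
    (hπ.1 0) (hπ.1 1) (by simpa [Fin.sum_univ_two] using hπ.2.2.2.1)

theorem isResolution_Q {π : ProjRep ![α₁, α₂] ![β₁, β₂] ![δ] γ H} (hπ : π.IsNondegenerate) :
    IsResolution π.Q := by
  have h := fun i j => congrArg π (ProjAlgebra.q_mul_q (α := ![α₁, α₂]) (β := ![β₁, β₂])
    (δ := ![δ]) (γ := γ) i j)
  simp only [map_mul] at h
  exact isResolution_of_projections (by simpa using h 0 0) (by simpa using h 0 1)
    (by simpa using h 1 0) (by simpa using h 1 1) (π.star_apply_gen _) (π.star_apply_gen _)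
    (hπ.2.1 0) (hπ.2.1 1) (by simpa [Fin.sum_univ_two] using hπ.2.2.2.2.1)

theorem isStarProjection_s (π : ProjRep ![α₁, α₂] ![β₁, β₂] ![δ] γ H) :
    IsStarProjection (π (ProjAlgebra.s 0)) where
  isIdempotentElem := by
    have h := congrArg π (ProjAlgebra.s_mul_s (α := ![α₁, α₂]) (β := ![β₁, β₂])
      (δ := ![δ]) (γ := γ) 0 0)
    rw [map_mul, if_pos rfl] at h
    exact h
  isSelfAdjoint := π.star_apply_gen _

theorem sum_P_add_sum_Q (π : ProjRep ![α₁, α₂] ![β₁, β₂] ![δ] γ H) :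
    ∑ i, ![0, (α₁ : ℂ), α₂] i • π.P i + ∑ i, ![0, (β₁ : ℂ), β₂] i • π.Q i
      + (δ : ℂ) • π (ProjAlgebra.s 0) = (γ : ℂ) • 1 := by
  have h := congrArg π (ProjAlgebra.sum_eq (α := ![α₁, α₂]) (β := ![β₁, β₂])
      (δ := ![δ]) (γ := γ))
  simp only [map_add, map_sum, map_smul, map_one] at h
  rw [← h]
  simp [Fin.sum_univ_three, Fin.sum_univ_two, P, Q]

/-- The space of an irreducible non-degenerate representation is three-dimensional. -/
theorem finrank_eq_three {π : ProjRep ![α₁, α₂] ![β₁, β₂] ![δ] γ H}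
    (hα₁ : α₁ ≠ 0) (hα₂ : α₂ ≠ 0) (hα : α₁ ≠ α₂) (hβ₁ : β₁ ≠ 0) (hβ₂ : β₂ ≠ 0) (hβ : β₁ ≠ β₂)
    (hδ : δ ≠ 0) (hirr : π.IsIrreducible) (hnd : π.IsNondegenerate) :
    Module.finrank ℂ H = 3 := by
  have hP := isResolution_P hnd
  have hQ := isResolution_Q hnd
  set S := π (ProjAlgebra.s 0) with hS
  set a : Fin 3 → ℂ := ![0, α₁, α₂] with ha
  set A := ∑ i, a i • π.P i with hAdef
  have haj : ∀ j, ∃ k l, j ≠ k ∧ j ≠ l ∧ k ≠ l ∧ (a j - a k) * (a j - a l) ≠ 0 := by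
    have h1 : (α₁ : ℂ) ≠ 0 := by exact_mod_cast hα₁
    have h2 : (α₂ : ℂ) ≠ 0 := by exact_mod_cast hα₂
    have h12 : (α₁ : ℂ) ≠ α₂ := by exact_mod_cast hα
    intro j
    fin_cases j
    · exact ⟨1, 2, by simp [ha, h1, h2]⟩
    · exact ⟨0, 2, by simp [ha, h1, sub_eq_zero, h12]⟩
    · exact ⟨0, 1, by simp [ha, h2, sub_eq_zero, h12.symm]⟩
  have hA := hP.cubic a
  have hC : (A + (δ : ℂ) • S - ((γ : ℂ) - ![0, (β₁ : ℂ), β₂] 0) • 1)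
      * (A + (δ : ℂ) • S - ((γ : ℂ) - ![0, (β₁ : ℂ), β₂] 1) • 1)
      * (A + (δ : ℂ) • S - ((γ : ℂ) - ![0, (β₁ : ℂ), β₂] 2) • 1) = 0 := by
    have hB := hQ.cubic ![0, (β₁ : ℂ), β₂]
    have hsum := π.sum_P_add_sum_Q
    have key : ∀ c : ℂ, A + (δ : ℂ) • S - ((γ : ℂ) - c) • 1
        = -(∑ i, ![0, (β₁ : ℂ), β₂] i • π.Q i - c • 1) := fun c => by
      rw [sub_smul, ← hsum]
      abel
    rw [key, key, key, neg_mul_neg, mul_neg, hB, neg_zero]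
  -- The eigenvector `e i` controls the two projections with index other than i; two choices of i
  -- cover all three.
  have main : ∀ i, FiniteDimensional ℂ H ∧ ∀ j, j ≠ i → ∃ w, ∀ y, ∃ c : ℂ, π.P j y = c • w := by
    intro i
    obtain ⟨e, he, hPe⟩ := hP.exists_orthonormal
    have hPA : ∀ j y, π.P j (A y) = a j • π.P j y := fun j y => by
      simp [hAdef, sum_apply, map_sum, hP.apply_apply]
    have hx : A (e i) = a i • e i := by
      have hpe : ∀ j, π.P j (e i) = if j = i then e i else 0 := fun j => by
        conv_lhs => rw [← hPe i, hP.apply_apply]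
        split_ifs with h
        · rw [h, hPe]
        · rfl
      simp [hAdef, hpe]
    obtain ⟨hVA, hVS⟩ := exists_invariant_submodule (a := a) (c := fun i => γ - ![0, (β₁ : ℂ), β₂] i)
      (Complex.ofReal_ne_zero.2 hδ) π.isStarProjection_s.isIdempotentElem hA hC hx
    set V := Submodule.span ℂ {e i, S (e i), A (S (e i)), A (A (S (e i)))} with hV
    have hfin : FiniteDimensional ℂ V := FiniteDimensional.span_of_finite ℂ (Set.toFinite _)
    have hVP : ∀ j, ∀ y ∈ V, π.P j y ∈ V := fun j y hy => by
      obtain ⟨k, l, hjk, hjl, hkl, hne⟩ := haj j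
      have h := congrArg (fun T : H →L[ℂ] H => T y) (hP.smul_eq_mul a hjk hjl hkl)
      rw [← Submodule.smul_mem_iff V hne]
      have hc : ∀ (c : ℂ), ∀ z ∈ V, (A - c • 1) z ∈ V := fun c z hz =>
        V.sub_mem (hVA z hz) (V.smul_mem c hz)
      exact (congrArg (· ∈ V) h).mpr (hc _ _ (hc _ _ hy))
    have htop : V = ⊤ := by
      refine (hirr.2 V V.closed_of_finiteDimensional (π.mem_of_mem hβ₁ hβ₂ hβ V
        (fun j => by fin_cases j; exacts [hVP 1, hVP 2]) fun d => ?_)).resolve_left fun h => ?_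
      · rw [Subsingleton.elim d 0]
        exact hVS
      · refine he.ne_zero i ((Submodule.mem_bot ℂ).1 ?_)
        rw [← h]
        exact Submodule.subset_span (by simp)
    refine ⟨Module.finite_def.2 (htop ▸ (Submodule.fg_iff_finiteDimensional V).2 hfin),
      fun j hj => ⟨π.P j (S (e i)), fun y => ?_⟩⟩
    have hy : y ∈ V := htop ▸ Submodule.mem_top
    -- `P j` kills `e i`, and P j A = a j P j sends the other three generators to multiples of P j S
    -- (e i).
    have hle : V ≤ (Submodule.span ℂ {π.P j (S (e i))}).comap (π.P j : H →ₗ[ℂ] H) := by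
      refine Submodule.span_le.2 ?_
      rintro z (rfl | rfl | rfl | rfl)
      · change π.P j (e i) ∈ Submodule.span ℂ {π.P j (S (e i))}
        rw [← hPe i, hP.apply_apply, if_neg hj]
        exact Submodule.zero_mem _
      · exact Submodule.mem_span_singleton_self _
      · change π.P j (A (S (e i))) ∈ Submodule.span ℂ {π.P j (S (e i))}
        rw [hPA]
        exact Submodule.smul_mem _ _ (Submodule.mem_span_singleton_self _)
      · change π.P j (A (A (S (e i)))) ∈ Submodule.span ℂ {π.P j (S (e i))}
        rw [hPA, hPA]
        exact Submodule.smul_mem _ _ (Submodule.smul_mem _ _ (Submodule.mem_span_singleton_self _))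
    obtain ⟨c, hc⟩ := Submodule.mem_span_singleton.1 (hle hy)
    exact ⟨c, hc.symm⟩
  have := (main 0).1
  refine hP.finrank_eq_three fun j => ?_
  obtain ⟨i, hi⟩ : ∃ i, j ≠ i := ⟨j + 1, by fin_cases j <;> simp⟩
  exact (main i).2 j hi

end ProjRep

/-! ### Phases of a basis and ranks of projections -/

section

variable {H : Type*} [NormedAddCommGroup H] [InnerProductSpace ℂ H]

/-- Multiplying each basis vector by the phase of its coordinate of v makes the coordinates positive
and leaves the rank one projections unchanged. -/
theorem OrthonormalBasis.exists_rephase (e : OrthonormalBasis (Fin 3) ℂ H) {v : H}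
    (hv : ∀ i, inner ℂ (e i) v ≠ 0) : ∃ f : OrthonormalBasis (Fin 3) ℂ H,
      (∀ i, InnerProductSpace.rankOne ℂ (f i) (f i) = InnerProductSpace.rankOne ℂ (e i) (e i)) ∧
      ∀ i, inner ℂ (f i) v = (‖inner ℂ (e i) v‖ : ℝ) := by
  set c : Fin 3 → ℂ := fun i => inner ℂ (e i) v / ‖inner ℂ (e i) v‖ with hc
  have hc1 : ∀ i, (starRingEnd ℂ) (c i) * c i = 1 := fun i => by
    have := Complex.ofReal_ne_zero.2 (norm_ne_zero_iff.2 (hv i))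
    rw [hc]
    simp only [map_div₀, Complex.conj_ofReal]
    rw [div_mul_div_comm, Complex.conj_mul', ← sq, div_self (pow_ne_zero 2 this)]
  have horth : Orthonormal ℂ fun i => c i • e i := by
    rw [orthonormal_iff_ite]
    intro i j
    rw [inner_smul_left, inner_smul_right, e.inner_eq_ite]
    split_ifs with h
    · rw [h, mul_one, hc1]
    · simp
  have h3 : Module.finrank ℂ H = 3 := by
    simpa using Module.finrank_eq_card_basis e.toBasis
  obtain ⟨f, hf⟩ := horth.exists_orthonormalBasis_eq h3
  refine ⟨f, fun i => ?_, fun i => ?_⟩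
  · ext x
    rw [hf, InnerProductSpace.rankOne_apply, InnerProductSpace.rankOne_apply, inner_smul_left,
      smul_smul]
    rw [mul_right_comm, hc1, one_mul]
  · have := Complex.ofReal_ne_zero.2 (norm_ne_zero_iff.2 (hv i))
    rw [hf, inner_smul_left, hc]
    simp only [map_div₀, Complex.conj_ofReal]
    rw [div_mul_eq_mul_div, Complex.conj_mul', sq, mul_div_cancel_right₀ _ this]

theorem finrank_range_rankOne_self {v : H} (hv : v ≠ 0) :
    Module.finrank ℂ (InnerProductSpace.rankOne ℂ v v).range = 1 := by
  have h : (InnerProductSpace.rankOne ℂ v v).range = Submodule.span ℂ {v} := by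
    refine le_antisymm ?_ ?_
    · rintro _ ⟨x, rfl⟩
      exact Submodule.smul_mem _ _ (Submodule.mem_span_singleton_self v)
    · rw [Submodule.span_singleton_le_iff_mem]
      refine ⟨(inner ℂ v v)⁻¹ • v, ?_⟩
      have h0 : inner ℂ v v ≠ 0 := inner_self_eq_zero.not.2 hv
      change inner ℂ v ((inner ℂ v v : ℂ)⁻¹ • v) • v = v
      rw [inner_smul_right, inv_mul_cancel₀ h0, one_smul]
  rw [h, finrank_span_singleton hv]

theorem IsStarProjection.finrank_range_add [CompleteSpace H] [FiniteDimensional ℂ H]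
    {T : H →L[ℂ] H} (hT : IsStarProjection T) :
    Module.finrank ℂ T.range + Module.finrank ℂ (1 - T).range = Module.finrank ℂ H := by
  have hTT : ∀ x, T (T x) = T x := fun x =>
    congrArg (fun R : H →L[ℂ] H => R x) hT.isIdempotentElem
  have h : (1 - T).range = T.ker := by
    ext x
    constructor
    · rintro ⟨y, rfl⟩
      simp [hTT]
    · intro hx
      have hx' : T x = 0 := hx
      exact ⟨x, by simp [hx']⟩
  rw [h]
  exact LinearMap.finrank_range_add_finrank_ker (T : H →ₗ[ℂ] H)

theorem ContinuousLinearMap.finrank_range_ne_zero [FiniteDimensional ℂ H] {T : H →L[ℂ] H}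
    (hT : T ≠ 0) : Module.finrank ℂ T.range ≠ 0 := by
  intro h
  refine hT (ContinuousLinearMap.ext fun x => ?_)
  have : T x ∈ T.range := ⟨x, rfl⟩
  rwa [Submodule.finrank_eq_zero.1 h, Submodule.mem_bot] at this

end

/-! ### Normal form and uniqueness -/

namespace ProjRep

variable {H : Type*} [NormedAddCommGroup H] [InnerProductSpace ℂ H] [CompleteSpace H]
  {α₁ α₂ β₁ β₂ δ γ : ℝ}

/-- In a suitable orthonormal basis the `π(p_i)` are coordinate projections, and
`δ π(s) = (γ - g) + ε v vᵀ` where `v` is a unit vector with positive coordinates determined by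
`SecularIdentity`. -/
def HasNormalForm (π : ProjRep ![α₁, α₂] ![β₁, β₂] ![δ] γ H) (g ε : ℝ) : Prop :=
  ∃ (e : OrthonormalBasis (Fin 3) ℂ H) (v : H) (r : Fin 3 → ℝ),
    ‖v‖ = 1 ∧ (∀ i, 0 < r i) ∧ (∀ i, inner ℂ (e i) v = r i) ∧
    (∀ i, π.P i = InnerProductSpace.rankOne ℂ (e i) (e i)) ∧
    (δ : ℂ) • π (ProjAlgebra.s 0)
      = ((γ - g : ℝ) : ℂ) • 1 + (ε : ℂ) • InnerProductSpace.rankOne ℂ v v ∧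
    SecularIdentity ![g, g - α₁, g - α₂] ![0, β₁, β₂] (fun i => r i ^ 2) ε

theorem HasNormalForm.sum_eq_one {π : ProjRep ![α₁, α₂] ![β₁, β₂] ![δ] γ H} {g ε : ℝ}
    (h : π.HasNormalForm g ε) : β₁ + β₂ + ε + α₁ + α₂ = 3 * g := by
  obtain ⟨e, v, r, hv, -, hr, -, -, hsec⟩ := h
  have ht := hsec.trace
  have h1 : r 0 ^ 2 + r 1 ^ 2 + r 2 ^ 2 = 1 := by
    have := e.sum_sq_norm_inner_right v
    simpa [hr, hv, Fin.sum_univ_three] using this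
  rw [h1] at ht
  simp at ht
  linarith

theorem hasNormalForm_of_smul_eq {π : ProjRep ![α₁, α₂] ![β₁, β₂] ![δ] γ H}
    (hβ₁ : β₁ ≠ 0) (hβ₂ : β₂ ≠ 0) (hβ : β₁ ≠ β₂) (hδ : δ ≠ 0)
    (hirr : π.IsIrreducible) (hnd : π.IsNondegenerate) (h3 : Module.finrank ℂ H = 3)
    {g ε : ℝ} {v : H} (hv : ‖v‖ = 1) (hs : (δ : ℂ) • π (ProjAlgebra.s 0)
      = ((γ - g : ℝ) : ℂ) • 1 + (ε : ℂ) • InnerProductSpace.rankOne ℂ v v) :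
    π.HasNormalForm g ε := by
  have hP := isResolution_P hnd
  have hQ := isResolution_Q hnd
  have hfin : FiniteDimensional ℂ H := Module.finite_of_finrank_pos (by omega)
  obtain ⟨e, he⟩ := hP.exists_orthonormalBasis h3
  obtain ⟨f, hf⟩ := hQ.exists_orthonormalBasis h3
  -- If v were orthogonal to `e i`, then `e i` would be a common eigenvector of the p's and s,
  -- spanning an invariant line in a three-dimensional space.
  have hev : ∀ i, inner ℂ (e i) v ≠ 0 := by
    intro i hi
    have hi' : inner ℂ v (e i) = 0 := by rw [← inner_conj_symm, hi, map_zero]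
    have hpe : ∀ j, ∃ c : ℂ, π.P j (e i) = c • e i := fun j => by
      rw [he, InnerProductSpace.rankOne_apply, e.inner_eq_ite]
      split_ifs with h
      · exact ⟨1, by rw [h]⟩
      · exact ⟨0, by simp⟩
    have hse : π (ProjAlgebra.s 0) (e i) = ((δ : ℂ)⁻¹ * ((γ - g : ℝ) : ℂ)) • e i := by
      have h := congrArg (fun T : H →L[ℂ] H => T (e i)) hs
      simp only [smul_apply, add_apply, one_apply_eq_self,
        InnerProductSpace.rankOne_apply, hi', zero_smul, smul_zero, add_zero] at h
      rw [mul_smul, ← h, inv_smul_smul₀ (Complex.ofReal_ne_zero.2 hδ)]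
    have hspan : ∀ (T : H →L[ℂ] H) (c : ℂ), T (e i) = c • e i →
        ∀ x ∈ Submodule.span ℂ {e i}, T x ∈ Submodule.span ℂ {e i} := fun T c hT x hx => by
      obtain ⟨d, rfl⟩ := Submodule.mem_span_singleton.1 hx
      rw [map_smul, hT]
      exact Submodule.smul_mem _ _ (Submodule.smul_mem _ _ (Submodule.mem_span_singleton_self _))
    have hinv : ∀ a, ∀ x ∈ Submodule.span ℂ {e i}, π a x ∈ Submodule.span ℂ {e i} := by
      refine π.mem_of_mem hβ₁ hβ₂ hβ _ (fun j => ?_) fun d => ?_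
      · obtain ⟨c, hc⟩ := hpe j.succ
        fin_cases j
        exacts [hspan _ c hc, hspan _ c hc]
      · rw [Subsingleton.elim d 0]
        exact hspan _ _ hse
    rcases hirr.2 _ (Submodule.closed_of_finiteDimensional _) hinv with h | h
    · exact e.orthonormal.ne_zero i (Submodule.span_singleton_eq_bot.1 h)
    · have h1 := finrank_span_singleton (K := ℂ) (e.orthonormal.ne_zero i)
      rw [h, finrank_top, h3] at h1
      omega
  obtain ⟨e', he', hv'⟩ := e.exists_rephase hev
  refine ⟨e', v, fun i => ‖inner ℂ (e i) v‖, hv, fun i => norm_pos_iff.2 (hev i), hv',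
    fun i => by rw [he', he], hs, fun z => ?_⟩
  have hsum := π.sum_P_add_sum_Q
  have hB : ∑ i, ![0, (β₁ : ℂ), β₂] i • InnerProductSpace.rankOne ℂ (f i) (f i)
      = ∑ i, ![(g : ℂ), g - α₁, g - α₂] i • InnerProductSpace.rankOne ℂ (e' i) (e' i)
        - (ε : ℂ) • InnerProductSpace.rankOne ℂ v v := by
    have h1 : ∑ i, ![(g : ℂ), g - α₁, g - α₂] i • π.P i
        = (g : ℂ) • 1 - ∑ i, ![0, (α₁ : ℂ), α₂] i • π.P i := by
      rw [← hP.sum, Finset.smul_sum, ← Finset.sum_sub_distrib]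
      refine Finset.sum_congr rfl fun i _ => ?_
      rw [← sub_smul]
      fin_cases i <;> simp
    simp only [he', ← he, ← hf, h1]
    rw [hs, ← eq_sub_iff_add_eq, ← eq_sub_iff_add_eq'] at hsum
    rw [hsum]
    push_cast
    module
  -- The characteristic polynomial of B is computed twice: in the eigenbasis `f` of B and as a rank
  -- one perturbation in the eigenbasis `e'` of A.
  have h1 := eval_charpoly_diagonal f ![0, (β₁ : ℂ), β₂] z
  rw [hB, eval_charpoly_diagonal_sub_rankOne e' _ _ hv'] at h1
  simp only [Matrix.cons_val_zero, Matrix.cons_val_one, Matrix.cons_val] at h1 ⊢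
  exact_mod_cast h1.symm

theorem normalForm_of_irreducible {π : ProjRep ![α₁, α₂] ![β₁, β₂] ![δ] γ H}
    (hβ₁ : β₁ ≠ 0) (hβ₂ : β₂ ≠ 0) (hβ : β₁ ≠ β₂) (hδ : δ ≠ 0)
    (hirr : π.IsIrreducible) (hnd : π.IsNondegenerate) (h3 : Module.finrank ℂ H = 3) :
    (π.HasNormalForm γ δ ∧ π.HasGeneralizedDimension 3 ![1, 1] ![1, 1] ![1]) ∨
    (π.HasNormalForm (γ - δ) (-δ) ∧ π.HasGeneralizedDimension 3 ![1, 1] ![1, 1] ![2]) := by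
  have hfin : FiniteDimensional ℂ H := Module.finite_of_finrank_pos (by omega)
  obtain ⟨e, he⟩ := (isResolution_P hnd).exists_orthonormalBasis h3
  obtain ⟨f, hf⟩ := (isResolution_Q hnd).exists_orthonormalBasis h3
  have hdim : ∀ n, Module.finrank ℂ (π (ProjAlgebra.s 0)).range = n →
      π.HasGeneralizedDimension 3 ![1, 1] ![1, 1] ![n] := by
    intro n hn
    have hPdim : ∀ j, Module.finrank ℂ (π.P j).range = 1 := fun j => by
      rw [he, finrank_range_rankOne_self (e.orthonormal.ne_zero j)]
    have hQdim : ∀ j, Module.finrank ℂ (π.Q j).range = 1 := fun j => by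
      rw [hf, finrank_range_rankOne_self (f.orthonormal.ne_zero j)]
    refine ⟨hfin, h3, fun i => ?_, fun i => ?_, fun i => ?_⟩
    · fin_cases i
      exacts [hPdim 1, hPdim 2]
    · fin_cases i
      exacts [hQdim 1, hQdim 2]
    · rw [Subsingleton.elim i 0]
      exact hn
  have hS := π.isStarProjection_s
  have hS1 : (1 : H →L[ℂ] H) - π (ProjAlgebra.s 0) ≠ 0 := by
    have := hnd.2.2.2.2.2
    rw [Fin.sum_univ_one] at this
    exact sub_ne_zero.2 this.symm
  have hr := hS.finrank_range_add
  have hr0 := ContinuousLinearMap.finrank_range_ne_zero (hnd.2.2.1 0)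
  have hr1 := ContinuousLinearMap.finrank_range_ne_zero hS1
  rw [h3] at hr
  -- The ranks of S and 1 - S are nonzero with sum 3, so one of them is 1; this one provides v.
  have hcases : Module.finrank ℂ (π (ProjAlgebra.s 0)).range = 1 ∨
    (Module.finrank ℂ (π (ProjAlgebra.s 0)).range = 2 ∧
      Module.finrank ℂ (1 - π (ProjAlgebra.s 0)).range = 1) := by omega
  rcases hcases with h1 | ⟨h2, h1⟩
  · refine Or.inl ⟨?_, hdim 1 h1⟩
    obtain ⟨v, hv, hSv⟩ := exists_eq_rankOne_of_finrank_range_eq_one hS h1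
    refine hasNormalForm_of_smul_eq hβ₁ hβ₂ hβ hδ hirr hnd h3 hv ?_
    rw [hSv]
    simp
  · refine Or.inr ⟨?_, hdim 2 h2⟩
    obtain ⟨v, hv, hSv⟩ := exists_eq_rankOne_of_finrank_range_eq_one hS.one_sub h1
    refine hasNormalForm_of_smul_eq hβ₁ hβ₂ hβ hδ hirr hnd h3 hv ?_
    rw [← hSv]
    push_cast
    module

/-- The secular identity determines the squared coordinates of v, and positivity the coordinates.
The unitary matching the two bases thus carries v to v' and intertwines the p's and s. -/
theorem HasNormalForm.unitarilyEquivalent {H' : Type*} [NormedAddCommGroup H']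
    [InnerProductSpace ℂ H'] [CompleteSpace H'] {π : ProjRep ![α₁, α₂] ![β₁, β₂] ![δ] γ H}
    {π' : ProjRep ![α₁, α₂] ![β₁, β₂] ![δ] γ H'} (hα₁ : α₁ ≠ 0) (hα₂ : α₂ ≠ 0) (hα : α₁ ≠ α₂)
    (hβ₁ : β₁ ≠ 0) (hβ₂ : β₂ ≠ 0) (hβ : β₁ ≠ β₂) (hδ : δ ≠ 0) {g ε : ℝ} (hε : ε ≠ 0)
    (h : π.HasNormalForm g ε) (h' : π'.HasNormalForm g ε) : π.UnitarilyEquivalent π' := by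
  obtain ⟨e, v, r, -, hr0, hr, hP, hS, hsec⟩ := h
  obtain ⟨e', v', r', -, hr0', hr', hP', hS', hsec'⟩ := h'
  have hrr := hsec.unique hsec' hε (fun h => hα₁ (by simpa using h.symm))
    (fun h => hα₂ (by simpa using h.symm)) (fun h => hα (by simpa using h))
  have hrr' : ∀ i, r i = r' i := fun i =>
    (sq_eq_sq₀ (hr0 i).le (hr0' i).le).1 (congrFun hrr i)
  let V : H ≃ₗᵢ[ℂ] H' := e.equiv e' (Equiv.refl _)
  have hVe : ∀ i, V (e i) = e' i := fun i => by simp [V]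
  have hVv : V v = v' := by
    rw [← e.sum_repr' v, ← e'.sum_repr' v', map_sum]
    refine Finset.sum_congr rfl fun i _ => ?_
    rw [map_smul, hVe, hr, hr', hrr']
  have hrank : ∀ w x, V (InnerProductSpace.rankOne ℂ w w x)
      = InnerProductSpace.rankOne ℂ (V w) (V w) (V x) := fun w x => by
    rw [InnerProductSpace.rankOne_apply, InnerProductSpace.rankOne_apply, V.inner_map_map,
      map_smul]
  have hVP : ∀ i x, V (π.P i x) = π'.P i (V x) := fun i x => by
    rw [hP, hP', hrank, hVe]
  refine ⟨V, π.intertwines π' hβ₁ hβ₂ hβ V (fun i => ?_) fun d x => ?_⟩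
  · fin_cases i
    exacts [hVP 1, hVP 2]
  · rw [Subsingleton.elim d 0]
    refine smul_right_injective H' (Complex.ofReal_ne_zero.2 hδ) ?_
    have h1 := congrArg (fun T : H →L[ℂ] H => V (T x)) hS
    have h2 := congrArg (fun T : H' →L[ℂ] H' => T (V x)) hS'
    simp only [smul_apply, add_apply, map_smul, map_add, one_apply_eq_self] at h1 h2
    rw [hrank, hVv] at h1
    exact h1.trans h2.symm

end ProjRep

/-! ### Solving the secular identity -/

namespace SecularIdentity

/-- The squares of `r` are the Lagrange coefficients. Among the denominators ∏ (d i - d j), j ≠ i,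
only that of i = 2 is negative, hence the reversed sign in `h2`. -/
theorem exists_of_sign {a₁ a₂ b₁ b₂ g ε : ℝ} (ha₂ : 0 < a₂) (ha : a₂ < a₁) (hε : ε ≠ 0)
    (h0 : 0 < g * (g - b₁) * (g - b₂) / ε)
    (h1 : 0 < (g - a₁) * (g - a₁ - b₁) * (g - a₁ - b₂) / ε)
    (h2 : (g - a₂) * (g - a₂ - b₁) * (g - a₂ - b₂) / ε < 0)
    (htr : 3 * g = ε + a₁ + a₂ + b₁ + b₂) :
    ∃ r : Fin 3 → ℝ, (∀ i, 0 < r i) ∧ r 0 ^ 2 + r 1 ^ 2 + r 2 ^ 2 = 1 ∧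
      SecularIdentity ![g, g - a₁, g - a₂] ![0, b₁, b₂] (fun i => r i ^ 2) ε := by
  have ha₁ : 0 < a₁ := ha₂.trans ha
  have ha' : 0 < a₁ - a₂ := sub_pos.2 ha
  set x : Fin 3 → ℝ := ![g * (g - b₁) * (g - b₂) / ε / (a₁ * a₂),
    (g - a₁) * (g - a₁ - b₁) * (g - a₁ - b₂) / ε / (a₁ * (a₁ - a₂)),
    -((g - a₂) * (g - a₂ - b₁) * (g - a₂ - b₂) / ε) / (a₂ * (a₁ - a₂))] with hx
  have hx0 : ∀ i, 0 < x i := fun i => by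
    fin_cases i
    · exact div_pos h0 (mul_pos ha₁ ha₂)
    · exact div_pos h1 (mul_pos ha₁ ha')
    · exact div_pos (neg_pos.2 h2) (mul_pos ha₂ ha')
  have hsec : SecularIdentity ![g, g - a₁, g - a₂] ![0, b₁, b₂] (fun i => Real.sqrt (x i) ^ 2) ε := by
    have h21 : a₂ - a₁ ≠ 0 := by linarith
    simp only [fun i => Real.sq_sqrt (hx0 i).le]
    refine of_lagrange ?_ ?_ ?_ ?_ ?_ ?_
    · simpa [eq_sub_iff_add_eq] using ha₁.ne'
    · simpa [eq_sub_iff_add_eq] using ha₂.ne'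
    · simpa using ha.ne'
    · simp [hx]
      field_simp
    · simp [hx]
      field_simp
      ring
    · simp [hx]
      field_simp
  refine ⟨fun i => Real.sqrt (x i), fun i => Real.sqrt_pos.2 (hx0 i), ?_, hsec⟩
  -- The trace gives ε ∑ (r i)² = ε when compared with `htr`.
  have ht := hsec.trace
  simp at ht
  refine mul_left_cancel₀ hε ?_
  linarith

end SecularIdentity

/-! ### Constructing representations from operators -/

namespace ProjRep

variable {H : Type*} [NormedAddCommGroup H] [InnerProductSpace ℂ H] [CompleteSpace H]

section OfOperators

variable {k l m : ℕ} {α : Fin k → ℝ} {β : Fin l → ℝ} {δ : Fin m → ℝ} {γ : ℝ}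

/-- The representation determined by self-adjoint operators satisfying the relations. -/
noncomputable def ofOperators (T : ProjGen k l m → H →L[ℂ] H) (hT : ∀ g, star (T g) = T g)
    (hrel : ∀ ⦃x y⦄, ProjRel α β δ γ x y → FreeAlgebra.lift ℂ T x = FreeAlgebra.lift ℂ T y) :
    ProjRep α β δ γ H :=
  let f : ProjAlgebra α β δ γ →ₐ[ℂ] (H →L[ℂ] H) :=
    RingQuot.liftAlgHom ℂ ⟨FreeAlgebra.lift ℂ T, hrel⟩
  have hf : ∀ g, f (ProjAlgebra.gen g) = T g := fun g =>
    (RingQuot.liftAlgHom_mkAlgHom_apply ℂ _ _ _).trans (FreeAlgebra.lift_ι_apply _ _)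
  { f with
    map_star' := fun a => by
      -- The elements at which f respects the involution form a subalgebra, and it contains the
      -- self-adjoint generators.
      let U : Subalgebra ℂ (ProjAlgebra α β δ γ) :=
        { carrier := {a | f (star a) = star (f a)}
          mul_mem' := fun {a b} (ha : f (star a) = star (f a)) (hb : f (star b) = star (f b)) => by
            change f (star (a * b)) = star (f (a * b))
            rw [star_mul, map_mul, map_mul, ha, hb, star_mul]
          add_mem' := fun {a b} (ha : f (star a) = star (f a)) (hb : f (star b) = star (f b)) => by
            change f (star (a + b)) = star (f (a + b))
            rw [star_add, map_add, map_add, ha, hb, star_add]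
          algebraMap_mem' := fun c => by
            change f (star (algebraMap ℂ _ c)) = star (f (algebraMap ℂ _ c))
            rw [Algebra.algebraMap_eq_smul_one, star_smul, star_one, map_smul, map_smul, map_one,
              star_smul, star_one] }
      have hU : U = ⊤ := ProjAlgebra.subalgebra_eq_top_of_gen_mem U fun g => by
        change f (star (ProjAlgebra.gen g)) = star (f (ProjAlgebra.gen g))
        rw [ProjAlgebra.star_gen, hf, hT]
      exact (hU ▸ Algebra.mem_top : a ∈ U) }

theorem ofOperators_gen (T : ProjGen k l m → H →L[ℂ] H) (hT : ∀ g, star (T g) = T g)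
    (hrel : ∀ ⦃x y⦄, ProjRel α β δ γ x y → FreeAlgebra.lift ℂ T x = FreeAlgebra.lift ℂ T y) (g) :
    ofOperators T hT hrel (ProjAlgebra.gen g) = T g :=
  (RingQuot.liftAlgHom_mkAlgHom_apply ℂ _ _ _).trans (FreeAlgebra.lift_ι_apply _ _)

theorem exists_of_operators {p : Fin k → H →L[ℂ] H} {q : Fin l → H →L[ℂ] H}
    {s : Fin m → H →L[ℂ] H} (hp : ∀ i j, p i * p j = if i = j then p i else 0)
    (hq : ∀ i j, q i * q j = if i = j then q i else 0)
    (hs : ∀ i j, s i * s j = if i = j then s i else 0)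
    (hp' : ∀ i, star (p i) = p i) (hq' : ∀ i, star (q i) = q i) (hs' : ∀ i, star (s i) = s i)
    (hsum : ∑ i, (α i : ℂ) • p i + ∑ j, (β j : ℂ) • q j + ∑ d, (δ d : ℂ) • s d = (γ : ℂ) • 1) :
    ∃ π : ProjRep α β δ γ H, (∀ i, π (ProjAlgebra.p i) = p i) ∧ (∀ i, π (ProjAlgebra.q i) = q i) ∧
      ∀ i, π (ProjAlgebra.s i) = s i := by
  let T : ProjGen k l m → H →L[ℂ] H := fun g => match g with
    | .p i => p i
    | .q i => q i
    | .s i => s i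
  have hT : ∀ g, star (T g) = T g := fun g => match g with
    | .p i => hp' i
    | .q i => hq' i
    | .s i => hs' i
  have hrel : ∀ ⦃x y⦄, ProjRel α β δ γ x y →
      FreeAlgebra.lift ℂ T x = FreeAlgebra.lift ℂ T y := by
    intro x y h
    cases h with
    | pp i j =>
      rw [map_mul, FreeAlgebra.lift_ι_apply, FreeAlgebra.lift_ι_apply]
      refine (hp i j).trans ?_
      split_ifs
      · exact (FreeAlgebra.lift_ι_apply (R := ℂ) T (.p i)).symm
      · exact (map_zero _).symm
    | qq i j =>
      rw [map_mul, FreeAlgebra.lift_ι_apply, FreeAlgebra.lift_ι_apply]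
      refine (hq i j).trans ?_
      split_ifs
      · exact (FreeAlgebra.lift_ι_apply (R := ℂ) T (.q i)).symm
      · exact (map_zero _).symm
    | ss i j =>
      rw [map_mul, FreeAlgebra.lift_ι_apply, FreeAlgebra.lift_ι_apply]
      refine (hs i j).trans ?_
      split_ifs
      · exact (FreeAlgebra.lift_ι_apply (R := ℂ) T (.s i)).symm
      · exact (map_zero _).symm
    | sum =>
      simp only [map_add, map_sum, map_smul, map_one, FreeAlgebra.lift_ι_apply]
      exact hsum
  exact ⟨ofOperators T hT hrel, fun i => ofOperators_gen T hT hrel (.p i),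
    fun i => ofOperators_gen T hT hrel (.q i), fun i => ofOperators_gen T hT hrel (.s i)⟩

end OfOperators

/-- The spectral projections of a self-adjoint operator with spectrum in `{0, β₁, β₂}`. -/
theorem exists_spectral_projections {B : H →L[ℂ] H} {β₁ β₂ : ℝ} (hβ₁ : β₁ ≠ 0) (hβ₂ : β₂ ≠ 0)
    (hβ : β₁ ≠ β₂) (hB : star B = B)
    (hcub : B * (B * B) = ((β₁ + β₂ : ℝ) : ℂ) • (B * B) - ((β₁ * β₂ : ℝ) : ℂ) • B)
    (hquad : ∀ c d : ℂ, B * B ≠ c • B + d • 1) :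
    ∃ q : Fin 2 → H →L[ℂ] H, (∀ i j, q i * q j = if i = j then q i else 0) ∧
      (∀ i, star (q i) = q i) ∧ ∑ i, (![β₁, β₂] i : ℂ) • q i = B ∧ (∀ i, q i ≠ 0) ∧
      ∑ i, q i ≠ 1 := by
  have h1 : (β₁ : ℂ) ≠ 0 := by exact_mod_cast hβ₁
  have h2 : (β₂ : ℂ) ≠ 0 := by exact_mod_cast hβ₂
  have h12 : (β₁ : ℂ) - β₂ ≠ 0 := sub_ne_zero.2 (by exact_mod_cast hβ)
  push_cast at hcub
  have hcub' : B * B * B = ((β₁ + β₂ : ℂ)) • (B * B) - (β₁ * β₂ : ℂ) • B := by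
    rw [mul_assoc, hcub]
  have hquart : B * B * (B * B) = ((β₁ + β₂ : ℂ)) • (((β₁ + β₂ : ℂ)) • (B * B) - (β₁ * β₂ : ℂ) • B)
      - (β₁ * β₂ : ℂ) • (B * B) := by
    rw [mul_assoc, hcub, mul_sub, mul_smul_comm, mul_smul_comm, hcub]
  set C := B * B with hC
  have hCs : star C = C := by rw [hC, star_mul, hB]
  -- Lagrange polynomials in B for the nodes 0, β₁, β₂: `q₁` and `q₂` take the value 1 at β₁ and β₂
  -- respectively and vanish at the other two nodes.
  set q₁ := (β₁ * (β₁ - β₂) : ℂ)⁻¹ • (C - (β₂ : ℂ) • B) with hq₁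
  set q₂ := (β₂ * (β₁ - β₂) : ℂ)⁻¹ • ((β₁ : ℂ) • B - C) with hq₂
  have e11 : q₁ * q₁ = q₁ := by
    simp only [hq₁, mul_sub, sub_mul, smul_mul_assoc, mul_smul_comm, hcub, hcub', hquart, ← hC]
    match_scalars <;> field_simp <;> ring
  have e12 : q₁ * q₂ = 0 := by
    simp only [hq₁, hq₂, mul_sub, sub_mul, smul_mul_assoc, mul_smul_comm, hcub, hcub', hquart, ← hC]
    match_scalars <;> field_simp <;> ring
  have e21 : q₂ * q₁ = 0 := by
    simp only [hq₁, hq₂, mul_sub, sub_mul, smul_mul_assoc, mul_smul_comm, hcub, hcub', hquart, ← hC]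
    match_scalars <;> field_simp <;> ring
  have e22 : q₂ * q₂ = q₂ := by
    simp only [hq₂, mul_sub, sub_mul, smul_mul_assoc, mul_smul_comm, hcub, hcub', hquart, ← hC]
    match_scalars <;> field_simp <;> ring
  have n1 : (β₁ * (β₁ - β₂) : ℂ) ≠ 0 := mul_ne_zero h1 h12
  have n2 : (β₂ * (β₁ - β₂) : ℂ) ≠ 0 := mul_ne_zero h2 h12
  refine ⟨![q₁, q₂], fun i j => ?_, fun i => ?_, ?_, fun i => ?_, ?_⟩
  · fin_cases i <;> fin_cases j <;> simp [e11, e12, e21, e22]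
  · fin_cases i <;> simp [hq₁, hq₂, hCs, hB]
  · simp only [Fin.sum_univ_two, Matrix.cons_val_zero, Matrix.cons_val_one, hq₁, hq₂]
    match_scalars <;> field_simp <;> ring
  -- If one of q₁, q₂, 1 - q₁ - q₂ vanished, B would be a root of a quadratic, contrary to `hquad`.
  · fin_cases i
    · intro h
      have h' : q₁ = 0 := h
      rw [hq₁, smul_eq_zero_iff_right (inv_ne_zero n1), sub_eq_zero] at h'
      exact hquad β₂ 0 (by rw [h', zero_smul, add_zero])
    · intro h
      have h' : q₂ = 0 := h
      rw [hq₂, smul_eq_zero_iff_right (inv_ne_zero n2), sub_eq_zero] at h'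
      exact hquad β₁ 0 (by rw [h', zero_smul, add_zero])
  · intro h
    refine hquad (β₁ + β₂) (-(β₁ * β₂)) ?_
    rw [← h]
    simp only [Fin.sum_univ_two, Matrix.cons_val_zero, Matrix.cons_val_one, hq₁, hq₂]
    match_scalars <;> field_simp <;> ring

end ProjRep

/-- A rank one perturbation, with all coordinates nonzero, of a diagonal operator with distinct
entries is not a root of a quadratic polynomial. -/
theorem mul_self_ne_of_rankOne {H : Type*} [NormedAddCommGroup H] [InnerProductSpace ℂ H]
    (e : OrthonormalBasis (Fin 3) ℂ H) {d : Fin 3 → ℂ} {ε : ℂ} {v : H}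
    {r : Fin 3 → ℝ} (hv : ‖v‖ = 1) (hr0 : ∀ i, r i ≠ 0) (hr : ∀ i, inner ℂ (e i) v = r i)
    (hε : ε ≠ 0) (hd : d 1 ≠ d 2) {B : H →L[ℂ] H}
    (hB : B = ∑ i, d i • InnerProductSpace.rankOne ℂ (e i) (e i)
      - ε • InnerProductSpace.rankOne ℂ v v) (c c' : ℂ) : B * B ≠ c • B + c' • 1 := by
  intro h
  have hr' : ∀ i, inner ℂ v (e i) = (r i : ℂ) := fun i => by
    rw [← inner_conj_symm, hr, Complex.conj_ofReal]
  have hvv : inner ℂ v v = (1 : ℂ) := by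
    rw [inner_self_eq_norm_sq_to_K, hv]
    simp
  have hBe : ∀ j, B (e j) = d j • e j - (ε * r j) • v := fun j => by
    simp [hB, hr', e.inner_eq_ite, mul_smul, -Complex.coe_smul]
  have hiB : ∀ i w, inner ℂ (e i) (B w) = d i * inner ℂ (e i) w - ε * r i * inner ℂ v w :=
    fun i w => by
      simp only [hB, sub_apply, sum_apply, smul_apply, InnerProductSpace.rankOne_apply,
        inner_sub_right, inner_sum, inner_smul_right, e.inner_eq_ite, hr]
      simp
      ring
  -- The (0, j) entries of B and B² are -ε r₀ rⱼ and -ε r₀ rⱼ (d₀ + dⱼ - ε). Taking j = 1 and j = 2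
  -- then forces d₁ = d₂.
  have key : ∀ j, j ≠ 0 → d 0 + d j - ε = c := fun j hj => by
    have h1 := congrArg (fun T : H →L[ℂ] H => inner ℂ (e 0) (T (e j))) h
    simp only [mul_apply_eq_comp, add_apply, smul_apply, one_apply_eq_self,
      inner_add_right, inner_smul_right, hiB] at h1
    rw [hBe, inner_sub_right, inner_smul_right, inner_smul_right, hvv, hr',
      e.inner_eq_zero hj.symm] at h1
    have hne : ε * r 0 * r j ≠ 0 := mul_ne_zero (mul_ne_zero hε (Complex.ofReal_ne_zero.2 (hr0 0)))
      (Complex.ofReal_ne_zero.2 (hr0 j))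
    refine mul_left_cancel₀ hne ?_
    linear_combination -h1
  exact hd (by linear_combination key 1 (by simp) - key 2 (by simp))

/-! ### Existence, and the two cases -/

namespace ProjRep

variable {H : Type*} [NormedAddCommGroup H] [InnerProductSpace ℂ H] [CompleteSpace H]
  {α₁ α₂ β₁ β₂ δ γ : ℝ}

theorem exists_irreducible [FiniteDimensional ℂ H] (e : OrthonormalBasis (Fin 3) ℂ H)
    {g ε : ℝ} {v : H} {r : Fin 3 → ℝ} (hα : α₁ ≠ α₂)
    (hβ₁ : β₁ ≠ 0) (hβ₂ : β₂ ≠ 0) (hβ : β₁ ≠ β₂) (hε : ε ≠ 0)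
    (hv : ‖v‖ = 1) (hr0 : ∀ i, 0 < r i) (hr : ∀ i, inner ℂ (e i) v = r i)
    (hsec : SecularIdentity ![g, g - α₁, g - α₂] ![0, β₁, β₂] (fun i => r i ^ 2) ε)
    {S : H →L[ℂ] H} (hS : IsStarProjection S) (hSv : (δ : ℂ) • S
      = ((γ - g : ℝ) : ℂ) • 1 + (ε : ℂ) • InnerProductSpace.rankOne ℂ v v) :
    ∃ π : ProjRep ![α₁, α₂] ![β₁, β₂] ![δ] γ H, π.IsIrreducible ∧ π.IsNondegenerate := by
  have hε' : (ε : ℂ) ≠ 0 := Complex.ofReal_ne_zero.2 hε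
  have hr' : ∀ i, inner ℂ v (e i) = (r i : ℂ) := fun i => by
    rw [← inner_conj_symm, hr, Complex.conj_ofReal]
  set E : Fin 3 → H →L[ℂ] H := fun i => InnerProductSpace.rankOne ℂ (e i) (e i) with hE
  have hEsum : ∑ i, E i = 1 := e.sum_rankOne_eq_id
  have hEstar : ∀ i, star (E i) = E i := fun i =>
    (InnerProductSpace.isStarProjection_rankOne_self (e.norm_eq_one i)).isSelfAdjoint.star_eq
  have hEmul : ∀ i j, E i * E j = if i = j then E i else 0 := fun i j => by
    ext x
    rw [mul_apply_eq_comp]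
    simp only [hE, InnerProductSpace.rankOne_apply, inner_smul_right, e.inner_eq_ite]
    split_ifs with h
    · simp [h]
    · simp
  set B : H →L[ℂ] H := ∑ i, ![(g : ℂ), g - α₁, g - α₂] i • E i
    - (ε : ℂ) • InnerProductSpace.rankOne ℂ v v with hB
  have hBstar : star B = B := by
    have hvstar : star (InnerProductSpace.rankOne ℂ v v) = InnerProductSpace.rankOne ℂ v v :=
      (InnerProductSpace.isStarProjection_rankOne_self hv).isSelfAdjoint.star_eq
    simp [hB, Fin.sum_univ_three, hEstar, hvstar]
  have hchar : (B : H →ₗ[ℂ] H).charpoly = Polynomial.X * (Polynomial.X - Polynomial.C (β₁ : ℂ))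
      * (Polynomial.X - Polynomial.C (β₂ : ℂ)) := by
    -- The secular identity is known at real points only; infinitely many points suffice.
    refine Polynomial.eq_of_infinite_eval_eq _ _
      ((Set.infinite_range_of_injective Complex.ofReal_injective).mono ?_)
    rintro _ ⟨z, rfl⟩
    have h := hsec z
    simp only [Matrix.cons_val_zero, Matrix.cons_val_one, Matrix.cons_val, sub_zero] at h
    simp only [Set.mem_ofPred_eq, Polynomial.eval_mul, Polynomial.eval_sub, Polynomial.eval_X,
      Polynomial.eval_C]
    rw [hB, eval_charpoly_diagonal_sub_rankOne e _ _ hr]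
    simp only [Matrix.cons_val_zero, Matrix.cons_val_one, Matrix.cons_val]
    exact_mod_cast h.symm
  have hcub : B * (B * B) = ((β₁ + β₂ : ℝ) : ℂ) • (B * B) - ((β₁ * β₂ : ℝ) : ℂ) • B := by
    have h := LinearMap.aeval_self_charpoly (B : H →ₗ[ℂ] H)
    rw [hchar] at h
    ext x
    have hx := congrArg (fun T : H →ₗ[ℂ] H => T x) h
    simp [Algebra.algebraMap_eq_smul_one] at hx
    simp only [mul_apply_eq_comp, sub_apply, smul_apply]
    rw [← sub_eq_zero, ← hx]
    push_cast
    module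
  have hquad := mul_self_ne_of_rankOne e hv (fun i => (hr0 i).ne') hr hε'
    (d := ![(g : ℂ), g - α₁, g - α₂]) (fun h => hα (by simpa using h)) hB
  obtain ⟨q, hq, hqstar, hqB, hq0, hq1⟩ :=
    exists_spectral_projections hβ₁ hβ₂ hβ hBstar hcub hquad
  have hBE : B = (γ : ℂ) • 1 - ∑ i, (![α₁, α₂] i : ℂ) • E i.succ - (δ : ℂ) • S := by
    rw [hSv, hB, ← hEsum]
    simp [Fin.sum_univ_three, -Complex.coe_smul]
    module
  obtain ⟨π, hp, hπq, hs⟩ := exists_of_operators (α := ![α₁, α₂]) (β := ![β₁, β₂]) (δ := ![δ])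
    (γ := γ) (p := fun i => E i.succ) (q := q) (s := fun _ => S)
    (fun i j => by simp [hEmul]) hq
    (fun i j => by rw [if_pos (Subsingleton.elim i j)]; exact hS.isIdempotentElem)
    (fun i => hEstar _) hqstar (fun i => hS.isSelfAdjoint.star_eq) (by
      rw [hqB, hBE]
      simp only [Fin.sum_univ_one, Matrix.cons_val_fin_one]
      abel)
  have hE0 : ∀ i, E i ≠ 0 := fun i => InnerProductSpace.rankOne_ne_zero
    (e.orthonormal.ne_zero i) (e.orthonormal.ne_zero i)
  have hEsum' : E 0 + (E 1 + E 2) = 1 := by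
    rw [← hEsum, Fin.sum_univ_three, add_assoc]
  -- The (0, 1) entry of δS is ε r₀ r₁ ≠ 0. The values c = 0 and c = 1 give the non-degeneracy of s.
  have hSc : ∀ c : ℂ, S ≠ c • 1 := fun c hc => by
    rw [hc] at hSv
    have h := congrArg (fun T : H →L[ℂ] H => inner ℂ (e 0) (T (e 1))) hSv
    simp [hr, hr', hε, (hr0 _).ne', e.inner_eq_ite,
      -Complex.coe_smul] at h
  refine ⟨π, ⟨⟨e 0, 0, e.orthonormal.ne_zero 0⟩, fun K _ hK => ?_⟩, fun i => ?_, fun i => ?_,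
    fun d => ?_, ?_, ?_, ?_⟩
  · have hKE : ∀ i, ∀ x ∈ K, E i x ∈ K := by
      have h1 : ∀ x ∈ K, E 1 x ∈ K := fun x hx => by
        have := hK (ProjAlgebra.p 0) x hx
        rwa [hp] at this
      have h2 : ∀ x ∈ K, E 2 x ∈ K := fun x hx => by
        have := hK (ProjAlgebra.p 1) x hx
        rwa [hp] at this
      intro i x hx
      fin_cases i
      · have h0 : E 0 x = x - (E 1 x + E 2 x) := by
          have := congrArg (fun T : H →L[ℂ] H => T x) hEsum'
          exact eq_sub_of_add_eq this
        exact h0 ▸ K.sub_mem hx (K.add_mem (h1 x hx) (h2 x hx))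
      · exact h1 x hx
      · exact h2 x hx
    have hKv : ∀ x ∈ K, inner ℂ v x • v ∈ K := fun x hx => by
      have h := congrArg (fun T : H →L[ℂ] H => T x) hSv
      simp only [smul_apply, add_apply, one_apply_eq_self, InnerProductSpace.rankOne_apply] at h
      rw [← Submodule.smul_mem_iff K hε', eq_sub_of_add_eq' h.symm]
      refine K.sub_mem (K.smul_mem _ ?_) (K.smul_mem _ hx)
      have := hK (ProjAlgebra.s 0) x hx
      rwa [hs] at this
    rw [or_iff_not_imp_left, Submodule.eq_bot_iff]
    intro hne
    push Not at hne
    obtain ⟨w, hw, hw0⟩ := hne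
    -- A nonzero invariant subspace contains some `e i`, hence v because r i ≠ 0, hence every `e j`
    -- because all coordinates of v are nonzero.
    obtain ⟨i, hi⟩ : ∃ i, inner ℂ (e i) w ≠ 0 := by
      by_contra! h
      apply hw0
      rw [← e.sum_repr' w]
      simp [h]
    have hei : e i ∈ K := (Submodule.smul_mem_iff K hi).1 (hKE i w hw)
    have hvK : v ∈ K := by
      refine (Submodule.smul_mem_iff K (Complex.ofReal_ne_zero.2 (hr0 i).ne')).1 (?_ :
        (r i : ℂ) • v ∈ K)
      rw [← hr' i]
      exact hKv _ hei
    have hej : ∀ j, e j ∈ K := fun j => by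
      have h := hKE j v hvK
      rw [hE, InnerProductSpace.rankOne_apply, hr] at h
      exact (Submodule.smul_mem_iff K (Complex.ofReal_ne_zero.2 (hr0 j).ne')).1 h
    rw [Submodule.eq_top_iff']
    intro x
    rw [← e.sum_repr' x]
    exact K.sum_mem fun j _ => K.smul_mem _ (hej j)
  · rw [hp]
    exact hE0 _
  · rw [hπq]
    exact hq0 _
  · rw [hs]
    simpa using hSc 0
  · simp only [hp]
    intro h
    rw [Fin.sum_univ_two] at h
    apply hE0 0
    have : E 1 + E 2 = 1 := h
    rwa [this, add_eq_right] at hEsum'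
  · simpa only [hπq] using hq1
  · simp only [hs, Fin.sum_univ_one]
    simpa using hSc 1

/-- The two alternatives in `hgε` correspond to S = vv* and S = 1 - vv*. `ULift` places the
coordinate space in any prescribed universe. -/
theorem exists_irreducible_of_sign {g ε : ℝ} (hα₂ : 0 < α₂) (hα : α₂ < α₁) (hβ₂ : 0 < β₂)
    (hβ : β₂ < β₁) (hδ : 0 < δ) (hgε : (g = γ ∧ ε = δ) ∨ (g = γ - δ ∧ ε = -δ))
    (h0 : 0 < g * (g - β₁) * (g - β₂) / ε)
    (h1 : 0 < (g - α₁) * (g - α₁ - β₁) * (g - α₁ - β₂) / ε)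
    (h2 : (g - α₂) * (g - α₂ - β₁) * (g - α₂ - β₂) / ε < 0)
    (htr : 3 * g = ε + α₁ + α₂ + β₁ + β₂) :
    ∃ π : ProjRep ![α₁, α₂] ![β₁, β₂] ![δ] γ (EuclideanSpace ℂ (ULift (Fin 3))),
      π.IsIrreducible ∧ π.IsNondegenerate := by
  have hε : ε ≠ 0 := by
    rcases hgε with ⟨-, rfl⟩ | ⟨-, rfl⟩
    · exact hδ.ne'
    · exact (neg_neg_of_pos hδ).ne
  obtain ⟨r, hr0, hr1, hsec⟩ := SecularIdentity.exists_of_sign hα₂ hα hε h0 h1 h2 htr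
  let e := (EuclideanSpace.basisFun (ULift (Fin 3)) ℂ).reindex Equiv.ulift
  set v : EuclideanSpace ℂ (ULift (Fin 3)) := ∑ i, (r i : ℂ) • e i with hv
  have hr : ∀ i, inner ℂ (e i) v = r i := fun i => by
    simp [hv, e.inner_eq_ite, -Complex.coe_smul]
  have hv1 : ‖v‖ = 1 := by
    have h := e.sum_sq_norm_inner_right v
    simp only [hr, Fin.sum_univ_three, Complex.norm_real, Real.norm_eq_abs, sq_abs, hr1] at h
    exact (pow_eq_one_iff_of_nonneg (norm_nonneg v) two_ne_zero).1 h.symm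
  have hproj := InnerProductSpace.isStarProjection_rankOne_self (𝕜 := ℂ) hv1
  have hβ₁ := hβ₂.trans hβ
  rcases hgε with ⟨rfl, rfl⟩ | ⟨rfl, rfl⟩
  · exact exists_irreducible e hα.ne' hβ₁.ne' hβ₂.ne' hβ.ne' hε hv1 hr0 hr
      hsec hproj (by simp)
  · exact exists_irreducible e hα.ne' hβ₁.ne' hβ₂.ne' hβ.ne' hε hv1 hr0 hr
      hsec hproj.one_sub (by push_cast; module)

theorem exists_irreducible_of_firstCase (hα₂ : 0 < α₂) (hα : α₂ < α₁) (hβ₂ : 0 < β₂)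
    (hβ : β₂ < β₁) (hδ : 0 < δ) (h : E6FirstCase α₁ α₂ β₁ β₂ δ γ) :
    ∃ π : ProjRep ![α₁, α₂] ![β₁, β₂] ![δ] γ (EuclideanSpace ℂ (ULift (Fin 3))),
      π.IsIrreducible ∧ π.IsNondegenerate := by
  obtain ⟨h1, h2, h3, h4, h5, htr⟩ := h
  refine exists_irreducible_of_sign hα₂ hα hβ₂ hβ hδ (Or.inl ⟨rfl, rfl⟩) ?_ ?_ ?_ htr
  · exact div_pos (mul_pos (mul_pos (by linarith) (by linarith)) (by linarith)) hδ
  · rw [mul_assoc]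
    exact div_pos (mul_pos (by linarith) (mul_pos_of_neg_of_neg (by linarith) (by linarith))) hδ
  · exact div_neg_of_neg_of_pos (mul_neg_of_neg_of_pos
      (mul_neg_of_pos_of_neg (by linarith) (by linarith)) (by linarith)) hδ

theorem exists_irreducible_of_secondCase (hα₂ : 0 < α₂) (hα : α₂ < α₁) (hβ₂ : 0 < β₂)
    (hβ : β₂ < β₁) (hδ : 0 < δ) (h : E6SecondCase α₁ α₂ β₁ β₂ δ γ) :
    ∃ π : ProjRep ![α₁, α₂] ![β₁, β₂] ![δ] γ (EuclideanSpace ℂ (ULift (Fin 3))),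
      π.IsIrreducible ∧ π.IsNondegenerate := by
  obtain ⟨h1, h2, h3, h4, h5, htr⟩ := h
  have hδ' := neg_neg_of_pos hδ
  refine exists_irreducible_of_sign hα₂ hα hβ₂ hβ hδ (Or.inr ⟨rfl, rfl⟩) ?_ ?_ ?_ (by linarith)
  · exact div_pos_of_neg_of_neg (mul_neg_of_neg_of_pos
      (mul_neg_of_pos_of_neg (by linarith) (by linarith)) (by linarith)) hδ'
  · refine div_pos_of_neg_of_neg ?_ hδ'
    rw [mul_assoc]
    exact mul_neg_of_neg_of_pos (by linarith) (mul_pos_of_neg_of_neg (by linarith) (by linarith))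
  · refine div_neg_of_pos_of_neg ?_ hδ'
    rw [mul_assoc]
    exact mul_pos (by linarith) (mul_pos_of_neg_of_neg (by linarith) (by linarith))

/-- The inequalities of each case are the interlacing inequalities with g = γ or g = γ - δ. The
normal form is kept in the conclusion because uniqueness rests on it. -/
theorem cases_of_irreducible {π : ProjRep ![α₁, α₂] ![β₁, β₂] ![δ] γ H} (hα₂ : 0 < α₂)
    (hα : α₂ < α₁) (hβ₂ : 0 < β₂) (hβ : β₂ < β₁) (hδ : 0 < δ)
    (hirr : π.IsIrreducible) (hnd : π.IsNondegenerate) :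
    (E6FirstCase α₁ α₂ β₁ β₂ δ γ ∧ π.HasNormalForm γ δ ∧
      π.HasGeneralizedDimension 3 ![1, 1] ![1, 1] ![1]) ∨
    (E6SecondCase α₁ α₂ β₁ β₂ δ γ ∧ π.HasNormalForm (γ - δ) (-δ) ∧
      π.HasGeneralizedDimension 3 ![1, 1] ![1, 1] ![2]) := by
  have hα₁ := hα₂.trans hα
  have hβ₁ := hβ₂.trans hβ
  have h3 := finrank_eq_three hα₁.ne' hα₂.ne' hα.ne' hβ₁.ne' hβ₂.ne' hβ.ne' hδ.ne' hirr hnd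
  rcases normalForm_of_irreducible hβ₁.ne' hβ₂.ne' hβ.ne' hδ.ne' hirr hnd h3 with
    ⟨hn, hdim⟩ | ⟨hn, hdim⟩
  · refine Or.inl ⟨?_, hn, hdim⟩
    have htr := hn.sum_eq_one
    obtain ⟨-, -, r, -, hr0, -, -, -, hsec⟩ := hn
    obtain ⟨h1, h2, h3, h4, h5⟩ :=
      hsec.interlacing_of_pos hα₂ hα hβ₂ hβ hδ fun i => pow_pos (hr0 i) 2
    exact ⟨by linarith, by linarith, by linarith, by linarith, by linarith, by linarith⟩
  · refine Or.inr ⟨?_, hn, hdim⟩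
    have htr := hn.sum_eq_one
    obtain ⟨-, -, r, -, hr0, -, -, -, hsec⟩ := hn
    obtain ⟨h1, h2, h3, h4, h5⟩ :=
      hsec.interlacing_of_neg hα₂ hα hβ₂ hβ hδ fun i => pow_pos (hr0 i) 2
    exact ⟨by linarith, by linarith, by linarith, by linarith, by linarith, by linarith⟩

end ProjRep

/-- Subtracting the two trace equations gives δ = 0. -/
theorem E6FirstCase.not_secondCase {α₁ α₂ β₁ β₂ δ γ : ℝ} (hδ : 0 < δ)
    (h : E6FirstCase α₁ α₂ β₁ β₂ δ γ) : ¬ E6SecondCase α₁ α₂ β₁ β₂ δ γ := fun h' => by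
  have h1 := h.2.2.2.2.2
  have h2 := h'.2.2.2.2.2
  linarith

theorem theorem2 (α₁ α₂ β₁ β₂ δ γ : ℝ)
    (hα₂ : 0 < α₂) (hα : α₂ < α₁) (hβ₂ : 0 < β₂) (hβ : β₂ < β₁) (hδ : 0 < δ) :
    -- irreducible non-degenerate representations occur only in the two cases,
    -- and there only in the indicated generalized dimension
    (∀ (H : Type u) [NormedAddCommGroup H] [InnerProductSpace ℂ H] [CompleteSpace H]
        (π : ProjRep ![α₁, α₂] ![β₁, β₂] ![δ] γ H), π.IsIrreducible → π.IsNondegenerate →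
        (E6FirstCase α₁ α₂ β₁ β₂ δ γ ∧ π.HasGeneralizedDimension 3 ![1, 1] ![1, 1] ![1]) ∨
        (E6SecondCase α₁ α₂ β₁ β₂ δ γ ∧ π.HasGeneralizedDimension 3 ![1, 1] ![1, 1] ![2])) ∧
    -- existence in the first case
    (E6FirstCase α₁ α₂ β₁ β₂ δ γ →
      ∃ (H : Type u) (_ : NormedAddCommGroup H) (_ : InnerProductSpace ℂ H) (_ : CompleteSpace H)
        (π : ProjRep ![α₁, α₂] ![β₁, β₂] ![δ] γ H), π.IsIrreducible ∧ π.IsNondegenerate ∧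
        π.HasGeneralizedDimension 3 ![1, 1] ![1, 1] ![1]) ∧
    -- existence in the second case
    (E6SecondCase α₁ α₂ β₁ β₂ δ γ →
      ∃ (H : Type u) (_ : NormedAddCommGroup H) (_ : InnerProductSpace ℂ H) (_ : CompleteSpace H)
        (π : ProjRep ![α₁, α₂] ![β₁, β₂] ![δ] γ H), π.IsIrreducible ∧ π.IsNondegenerate ∧
        π.HasGeneralizedDimension 3 ![1, 1] ![1, 1] ![2]) ∧
    -- uniqueness up to unitary equivalence
    (∀ (H : Type u) [NormedAddCommGroup H] [InnerProductSpace ℂ H] [CompleteSpace H]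
        (H' : Type v) [NormedAddCommGroup H'] [InnerProductSpace ℂ H'] [CompleteSpace H']
        (π : ProjRep ![α₁, α₂] ![β₁, β₂] ![δ] γ H) (π' : ProjRep ![α₁, α₂] ![β₁, β₂] ![δ] γ H'),
        π.IsIrreducible → π.IsNondegenerate → π'.IsIrreducible → π'.IsNondegenerate →
        π.UnitarilyEquivalent π') := by
  have hα₁ := hα₂.trans hα
  have hβ₁ := hβ₂.trans hβ
  refine ⟨fun H _ _ _ π hirr hnd => ?_, fun h => ?_, fun h => ?_,
    fun H _ _ _ H' _ _ _ π π' hirr hnd hirr' hnd' => ?_⟩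
  · exact (ProjRep.cases_of_irreducible hα₂ hα hβ₂ hβ hδ hirr hnd).imp
      (fun h => ⟨h.1, h.2.2⟩) fun h => ⟨h.1, h.2.2⟩
  · obtain ⟨π, hirr, hnd⟩ := ProjRep.exists_irreducible_of_firstCase hα₂ hα hβ₂ hβ hδ h
    refine ⟨EuclideanSpace ℂ (ULift (Fin 3)), _, _, inferInstance, π, hirr, hnd, ?_⟩
    -- The dimension of the constructed representation is read off from the classification, the
    -- other case being excluded.
    rcases ProjRep.cases_of_irreducible hα₂ hα hβ₂ hβ hδ hirr hnd with h' | h'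
    · exact h'.2.2
    · exact absurd h'.1 (h.not_secondCase hδ)
  · obtain ⟨π, hirr, hnd⟩ := ProjRep.exists_irreducible_of_secondCase hα₂ hα hβ₂ hβ hδ h
    refine ⟨EuclideanSpace ℂ (ULift (Fin 3)), _, _, inferInstance, π, hirr, hnd, ?_⟩
    rcases ProjRep.cases_of_irreducible hα₂ hα hβ₂ hβ hδ hirr hnd with h' | h'
    · exact absurd h (h'.1.not_secondCase hδ)
    · exact h'.2.2
  · have key {g ε : ℝ} (hε : ε ≠ 0) (h : π.HasNormalForm g ε) (h' : π'.HasNormalForm g ε) :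
        π.UnitarilyEquivalent π' :=
      h.unitarilyEquivalent hα₁.ne' hα₂.ne' hα.ne' hβ₁.ne' hβ₂.ne' hβ.ne' hδ.ne' hε h'
    rcases ProjRep.cases_of_irreducible hα₂ hα hβ₂ hβ hδ hirr hnd with h | h <;>
    rcases ProjRep.cases_of_irreducible hα₂ hα hβ₂ hβ hδ hirr' hnd' with h' | h'
    · exact key hδ.ne' h.2.1 h'.2.1
    · exact absurd h'.1 (h.1.not_secondCase hδ)
    · exact absurd h.1 (h'.1.not_secondCase hδ)
    · exact key (neg_neg_of_pos hδ).ne h.2.1 h'.2.1
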